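/- Let $k$ be a field, $R=k[x_1,\dots,x_n]$ with the standard grading, $I\subseteq R$ a homogeneous ideal and $d$ a positive integer. Let $I_{\ge d}$ be the ideal generated by the homogeneous elements of $I$ of degree at least $d$. For a homogeneous ideal $J$ let $\beta_{i,j}^{R/J}$ be the graded Betti numbers of $R/J$, that is, the number of basis elements of degree $j$ in the $i$-th free module of the minimal graded free resolution of $R/J$ over $R$, and let $M_i^{R/J}=\max\{\,j : \beta_{i,j}^{R/J}\neq 0\,\}$. (1) For all integers $i\ge 0$ and $l\ge 0$, $$\beta_{i,i+d+l}^{R/I}=\beta_{i,i+d+l}^{R/I_{\ge d}},$$ that is, rows $d$ and higher of the Betti diagrams of $R/I$ and $R/I_{\ge d}$ are the same. (2) Suppose moreover that $R/I$ is Cohen–Macaulay and that the highest degree of a minimal generator of $I$ is at least $d$. Then for all $1\le i\le \operatorname{codim} I$ the maxima $M_i^{R/I}$ and $M_i^{R/I_{\ge d}}$ exist (the sets are non-empty), and $$M_i^{R/I}=M_i^{R/I_{\ge d}}.$$ -/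

import Mathlib

attribute [local instance] MvPolynomial.gradedAlgebra

namespace TruncBetti

open MvPolynomial

/-- `f` is homogeneous of the integer degree `e`: all its monomials have degree `e`
(so `f = 0` if `e < 0`). -/
def IntHomog {n : ℕ} {k : Type*} [Field k] (f : MvPolynomial (Fin n) k) (e : ℤ) : Prop :=
  ∀ m : Fin n →₀ ℕ, coeff m f ≠ 0 → (m.degree : ℤ) = e

/-- A minimal graded free resolution
`⋯ → F₂ → F₁ → F₀ → R/I → 0` over `R = k[x₁, …, xₙ]`, where `Fᵢ = ⨁_b R(-shift i b)` with
`b` running over `Fin (rank i)`. -/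
structure MinimalGradedFreeResolution {n : ℕ} {k : Type*} [Field k]
    (I : Ideal (MvPolynomial (Fin n) k)) where
  /-- the rank of `Fᵢ` -/
  rank : ℕ → ℕ
  /-- the degrees of the basis elements of `Fᵢ` -/
  shift : (i : ℕ) → Fin (rank i) → ℤ
  /-- the augmentation `F₀ → R/I` -/
  aug : (Fin (rank 0) → MvPolynomial (Fin n) k) →ₗ[MvPolynomial (Fin n) k]
    (MvPolynomial (Fin n) k ⧸ I)
  /-- the differential `Fᵢ₊₁ → Fᵢ` -/
  diff : (i : ℕ) → (Fin (rank (i + 1)) → MvPolynomial (Fin n) k) →ₗ[MvPolynomial (Fin n) k]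
    (Fin (rank i) → MvPolynomial (Fin n) k)
  /-- the augmentation is homogeneous of degree `0` -/
  aug_homog : ∀ b, ∃ f : MvPolynomial (Fin n) k, IntHomog f (shift 0 b) ∧
    aug (Pi.single b 1) = Ideal.Quotient.mk I f
  /-- the differentials are homogeneous of degree `0` -/
  diff_homog : ∀ i b a, IntHomog (diff i (Pi.single b 1) a) (shift (i + 1) b - shift i a)
  aug_surjective : Function.Surjective aug
  exact_aug : Function.Exact (diff 0) aug
  exact_diff : ∀ i, Function.Exact (diff (i + 1)) (diff i)
  /-- minimality: the entries of the differentials lie in `(x₁, …, xₙ)` -/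
  minimal : ∀ i b a, diff i (Pi.single b 1) a ∈ idealOfVars (Fin n) k

/-- The number of basis elements of degree `j` of the `i`-th module of the resolution. -/
def MinimalGradedFreeResolution.betti {n : ℕ} {k : Type*} [Field k]
    {I : Ideal (MvPolynomial (Fin n) k)} (F : MinimalGradedFreeResolution I)
    (i : ℕ) (j : ℤ) : ℕ :=
  (Finset.univ.filter fun b => F.shift i b = j).card

/-! ### Existence of minimal graded free resolutions -/

section Existence

variable {n : ℕ} {k : Type*} [Field k]

/-- The component of integer degree `e` of a polynomial. -/
noncomputable def compZ (e : ℤ) (f : MvPolynomial (Fin n) k) : MvPolynomial (Fin n) k :=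
  if 0 ≤ e then homogeneousComponent e.toNat f else 0

theorem coeff_compZ (e : ℤ) (f : MvPolynomial (Fin n) k) (m : Fin n →₀ ℕ) :
    coeff m (compZ e f) = if (m.degree : ℤ) = e then coeff m f else 0 := by
  unfold compZ
  by_cases h : 0 ≤ e
  · rw [if_pos h, coeff_homogeneousComponent]
    have : (m.degree = e.toNat) ↔ ((m.degree : ℤ) = e) := by omega
    simp [this]
  · rw [if_neg h, if_neg (by omega), coeff_zero]

theorem compZ_mul (e g : ℤ) (f h : MvPolynomial (Fin n) k) (hh : IntHomog h g) :
    compZ (e + g) (f * h) = compZ e f * h := by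
  ext m
  rw [coeff_compZ, coeff_mul, coeff_mul]
  by_cases hm : (m.degree : ℤ) = e + g
  · rw [if_pos hm]
    refine Finset.sum_congr rfl fun p hp => ?_
    rw [coeff_compZ]
    by_cases h0 : coeff p.2 h = 0
    · simp [h0]
    · have h1 := hh _ h0
      rw [Finset.HasAntidiagonal.mem_antidiagonal] at hp
      rw [← hp, map_add] at hm
      push_cast at hm
      rw [if_pos (by omega)]
  · rw [if_neg hm]
    symm
    refine Finset.sum_eq_zero fun p hp => ?_
    rw [coeff_compZ]
    by_cases h0 : coeff p.2 h = 0
    · simp [h0]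
    · have h1 := hh _ h0
      rw [Finset.HasAntidiagonal.mem_antidiagonal] at hp
      rw [← hp, map_add] at hm
      push_cast at hm
      rw [if_neg (by omega), zero_mul]

/-- The component of degree `e` of an element of the free module with shifts `s`. -/
noncomputable def comp {r : ℕ} (s : Fin r → ℤ) (e : ℤ) (v : Fin r → MvPolynomial (Fin n) k) :
    Fin r → MvPolynomial (Fin n) k := fun a => compZ (e - s a) (v a)

/-- Homogeneous elements of the free module with shifts `s`. -/
def VecHomog {r : ℕ} (s : Fin r → ℤ) (v : Fin r → MvPolynomial (Fin n) k) (e : ℤ) : Prop :=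
  ∀ a, IntHomog (v a) (e - s a)

theorem comp_homog {r : ℕ} (s : Fin r → ℤ) (e : ℤ) (v : Fin r → MvPolynomial (Fin n) k) :
    VecHomog s (comp s e v) e := by
  intro a m hm
  unfold comp at hm
  rw [coeff_compZ] at hm
  by_contra h
  exact hm (if_neg h)

theorem exists_sum_comp {r : ℕ} (s : Fin r → ℤ) (v : Fin r → MvPolynomial (Fin n) k) :
    ∃ E : Finset ℤ, v = ∑ e ∈ E, comp s e v := by
  classical
  refine ⟨Finset.univ.biUnion fun a => (v a).support.image fun m => (m.degree : ℤ) + s a, ?_⟩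
  ext a m
  rw [Finset.sum_apply, coeff_sum]
  unfold comp
  simp only [coeff_compZ]
  by_cases h : coeff m (v a) = 0
  · simp [h]
  · rw [Finset.sum_eq_single ((m.degree : ℤ) + s a)]
    · simp
    · intro e _ he
      rw [if_neg (by omega)]
    · intro hn
      refine absurd ?_ hn
      simp only [Finset.mem_biUnion, Finset.mem_univ, true_and, Finset.mem_image]
      exact ⟨a, m, by simpa using h, rfl⟩

/-- Graded submodules of the free module with shifts `s`. -/
def IsGraded {r : ℕ} (s : Fin r → ℤ)
    (N : Submodule (MvPolynomial (Fin n) k) (Fin r → MvPolynomial (Fin n) k)) : Prop :=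
  ∀ v ∈ N, ∀ e, comp s e v ∈ N

/-- A homogeneous family spanning `N`. -/
def Gens {r : ℕ} (s : Fin r → ℤ)
    (N : Submodule (MvPolynomial (Fin n) k) (Fin r → MvPolynomial (Fin n) k)) (m : ℕ)
    (t : Fin m → ℤ) (g : Fin m → Fin r → MvPolynomial (Fin n) k) : Prop :=
  (∀ b, VecHomog s (g b) (t b)) ∧ Submodule.span _ (Set.range g) = N

theorem exists_gens {r : ℕ} (s : Fin r → ℤ)
    (N : Submodule (MvPolynomial (Fin n) k) (Fin r → MvPolynomial (Fin n) k))
    (hN : IsGraded s N) : ∃ m t g, Gens s N m t g := by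
  have hspan : Submodule.span (MvPolynomial (Fin n) k) {v | v ∈ N ∧ ∃ e, VecHomog s v e} = N := by
    apply le_antisymm
    · rw [Submodule.span_le]
      exact fun v hv => hv.1
    · intro v hv
      obtain ⟨E, hE⟩ := exists_sum_comp s v
      rw [hE]
      exact Submodule.sum_mem _ fun e _ =>
        Submodule.subset_span ⟨hN v hv e, e, comp_homog s e v⟩
  have hfg : (Submodule.span (MvPolynomial (Fin n) k)
      {v | v ∈ N ∧ ∃ e, VecHomog s v e}).FG := IsNoetherian.noetherian _
  obtain ⟨S, hS, hS'⟩ := (Submodule.fg_span_iff_fg_span_finset_subset _).1 hfg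
  have hS2 : ∀ x : S, ∃ e, VecHomog s x.1 e := fun x => (hS x.2).2
  choose t ht using hS2
  refine ⟨S.card, fun b => t (S.equivFin.symm b), fun b => (S.equivFin.symm b).1,
    fun b => ht _, ?_⟩
  rw [← hspan, hS']
  congr 1
  ext x
  constructor
  · rintro ⟨b, rfl⟩
    exact (S.equivFin.symm b).2
  · intro hx
    exact ⟨S.equivFin ⟨x, hx⟩, by simp⟩

/-- The map out of a free module given by the images of the basis vectors. -/
noncomputable def lin {r m : ℕ} (g : Fin m → Fin r → MvPolynomial (Fin n) k) :
    (Fin m → MvPolynomial (Fin n) k) →ₗ[MvPolynomial (Fin n) k]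
      (Fin r → MvPolynomial (Fin n) k) :=
  Fintype.linearCombination _ g

theorem lin_single {r m : ℕ} (g : Fin m → Fin r → MvPolynomial (Fin n) k) (b : Fin m) :
    lin g (Pi.single b 1) = g b := by
  classical
  simp [lin, Fintype.linearCombination_apply_single]

theorem lin_apply {r m : ℕ} (g : Fin m → Fin r → MvPolynomial (Fin n) k)
    (c : Fin m → MvPolynomial (Fin n) k) (a : Fin r) : lin g c a = ∑ b, c b * g b a := by
  simp [lin, Fintype.linearCombination_apply, Finset.sum_apply]

theorem compZ_sum {ι : Type*} (S : Finset ι) (e : ℤ) (f : ι → MvPolynomial (Fin n) k) :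
    compZ e (∑ b ∈ S, f b) = ∑ b ∈ S, compZ e (f b) := by
  ext m
  simp only [coeff_compZ, coeff_sum]
  split_ifs <;> simp

theorem comp_lin {r m : ℕ} (s : Fin r → ℤ) (t : Fin m → ℤ)
    (g : Fin m → Fin r → MvPolynomial (Fin n) k) (hg : ∀ b, VecHomog s (g b) (t b))
    (e : ℤ) (c : Fin m → MvPolynomial (Fin n) k) :
    comp s e (lin g c) = lin g (comp t e c) := by
  funext a
  rw [lin_apply]
  unfold comp
  rw [lin_apply, compZ_sum]
  refine Finset.sum_congr rfl fun b _ => ?_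
  rw [← compZ_mul _ _ _ _ (hg b a)]
  congr 1
  ring

theorem comp_zero {r : ℕ} (s : Fin r → ℤ) (e : ℤ) :
    comp s e (0 : Fin r → MvPolynomial (Fin n) k) = 0 := by
  funext a
  ext m
  simp [comp, coeff_compZ]

theorem graded_ker {r m : ℕ} (s : Fin r → ℤ) (t : Fin m → ℤ)
    (g : Fin m → Fin r → MvPolynomial (Fin n) k) (hg : ∀ b, VecHomog s (g b) (t b)) :
    IsGraded t (LinearMap.ker (lin g)) := by
  intro c hc e
  rw [LinearMap.mem_ker] at hc ⊢
  rw [← comp_lin s t g hg, hc, comp_zero]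

theorem exists_min_gens {r : ℕ} (s : Fin r → ℤ)
    (N : Submodule (MvPolynomial (Fin n) k) (Fin r → MvPolynomial (Fin n) k))
    (hN : IsGraded s N) : ∃ m t g, Gens s N m t g ∧
      ∀ c ∈ LinearMap.ker (lin g), ∀ b, constantCoeff (c b) = 0 := by
  classical
  have hex : ∃ m, ∃ t g, Gens s N m t g := exists_gens s N hN
  obtain ⟨t, g, hg⟩ := Nat.find_spec hex
  refine ⟨Nat.find hex, t, g, hg, ?_⟩
  intro c hc b
  by_contra hu
  have hlt := @Nat.find_min _ _ hex
  generalize Nat.find hex = m at t g hg c hc b hu hlt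
  obtain _ | m := m
  · exact b.elim0
  refine hlt (Nat.lt_succ_self m)
    ⟨fun a => t (b.succAbove a), fun a => g (b.succAbove a), fun a => hg.1 _, ?_⟩
  rw [← hg.2]
  apply le_antisymm
  · apply Submodule.span_mono
    rintro _ ⟨a, rfl⟩
    exact ⟨_, rfl⟩
  · rw [Submodule.span_le]
    rintro _ ⟨a, rfl⟩
    by_cases hab : a = b
    · subst hab
      have h1 := graded_ker s t g hg.1 c hc (t a)
      rw [LinearMap.mem_ker] at h1
      have h2 : comp t (t a) c a = C (constantCoeff (c a)) := by
        ext m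
        unfold comp
        rw [coeff_compZ, coeff_C, constantCoeff_eq]
        by_cases hm : m = 0
        · subst hm; simp
        · have : m.degree ≠ 0 := by simpa [Finsupp.degree_eq_zero_iff] using hm
          rw [if_neg (by omega), if_neg (Ne.symm hm)]
      have h3 : lin g (comp t (t a) c) = comp t (t a) c a • g a +
          ∑ i, comp t (t a) c (a.succAbove i) • g (a.succAbove i) := by
        rw [lin, Fintype.linearCombination_apply, Fin.sum_univ_succAbove _ a]
      rw [h1, h2] at h3
      have h4 : g a = (-C (constantCoeff (c a))⁻¹ : MvPolynomial (Fin n) k) •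
          ∑ i, comp t (t a) c (a.succAbove i) • g (a.succAbove i) := by
        have h5 := eq_neg_of_add_eq_zero_right h3.symm
        rw [h5, smul_neg, neg_smul, neg_neg, smul_smul, ← C_mul, inv_mul_cancel₀ hu, C_1,
          one_smul]
      rw [SetLike.mem_coe, h4]
      refine Submodule.smul_mem _ _ (Submodule.sum_mem _ fun i _ => Submodule.smul_mem _ _ ?_)
      exact Submodule.subset_span ⟨i, rfl⟩
    · obtain ⟨i, rfl⟩ := Fin.exists_succAbove_eq hab
      exact Submodule.subset_span ⟨i, rfl⟩

/-- A graded submodule, all of whose elements have entries in `(x₁, …, xₙ)`, of a graded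
free module of finite rank. -/
structure Stage (n : ℕ) (k : Type*) [Field k] where
  /-- the rank -/
  r : ℕ
  /-- the shifts -/
  s : Fin r → ℤ
  /-- the submodule -/
  N : Submodule (MvPolynomial (Fin n) k) (Fin r → MvPolynomial (Fin n) k)
  graded : IsGraded s N
  small : ∀ c ∈ N, ∀ b, constantCoeff (c b) = 0

theorem Stage.exists_next (A : Stage n k) :
    ∃ (B : Stage n k) (g : Fin B.r → Fin A.r → MvPolynomial (Fin n) k),
      Gens A.s A.N B.r B.s g ∧ B.N = LinearMap.ker (lin g) := by
  obtain ⟨m, t, g, hg, hmin⟩ := exists_min_gens A.s A.N A.graded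
  exact ⟨⟨m, t, LinearMap.ker (lin g), graded_ker _ _ _ hg.1, hmin⟩, g, hg, rfl⟩

/-- The next stage. -/
noncomputable def Stage.next (A : Stage n k) : Stage n k := A.exists_next.choose

theorem Stage.next_spec (A : Stage n k) :
    ∃ (g : Fin A.next.r → Fin A.r → MvPolynomial (Fin n) k),
      Gens A.s A.N A.next.r A.next.s g ∧ A.next.N = LinearMap.ker (lin g) :=
  A.exists_next.choose_spec

/-- The sequence of stages. -/
noncomputable def Stage.iter (A : Stage n k) : ℕ → Stage n k
  | 0 => A
  | i + 1 => (A.iter i).next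

theorem exists_stage_zero (I : HomogeneousIdeal (homogeneousSubmodule (Fin n) k)) :
    ∃ (A : Stage n k) (aug : (Fin A.r → MvPolynomial (Fin n) k) →ₗ[MvPolynomial (Fin n) k]
      (MvPolynomial (Fin n) k ⧸ I.toIdeal)),
      (∀ b, ∃ f, IntHomog f (A.s b) ∧ aug (Pi.single b 1) = Ideal.Quotient.mk I.toIdeal f) ∧
      Function.Surjective aug ∧ LinearMap.ker aug = A.N := by
  by_cases hI : I.toIdeal = ⊤
  · refine ⟨⟨0, fun _ => 0, ⊥, ?_, ?_⟩, 0, fun b => b.elim0, ?_, ?_⟩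
    · intro v hv e
      rw [Submodule.mem_bot] at hv ⊢
      rw [hv, comp_zero]
    · intro c _ b
      exact b.elim0
    · intro x
      exact ⟨0, (Ideal.Quotient.subsingleton_iff.2 hI).elim _ _⟩
    · exact (Submodule.eq_bot_of_subsingleton)
  · have hcomp : ∀ f ∈ I.toIdeal, ∀ e, homogeneousComponent e f ∈ I.toIdeal := fun f hf =>
      (mem_iff_homogeneousComponent_mem I.isHomogeneous f).1 hf
    refine ⟨⟨1, fun _ => 0, Submodule.comap (LinearMap.proj 0) I.toIdeal, ?_, ?_⟩,
      (Submodule.mkQ I.toIdeal).comp (LinearMap.proj 0), ?_, ?_, ?_⟩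
    · intro v hv e
      change compZ _ (v 0) ∈ I.toIdeal
      unfold compZ
      split_ifs
      · exact hcomp _ hv _
      · exact I.toIdeal.zero_mem
    · intro c hc b
      obtain rfl : b = 0 := Subsingleton.elim _ _
      have h1 := hcomp _ hc 0
      rw [LinearMap.proj_apply, homogeneousComponent_zero] at h1
      by_contra hu
      exact hI (Ideal.eq_top_of_isUnit_mem _ h1 ((Ne.isUnit hu).map C))
    · intro b
      obtain rfl : b = 0 := Subsingleton.elim _ _
      refine ⟨1, ?_, by simp⟩
      intro m hm
      by_cases h : m = 0
      · subst h; simp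
      · rw [coeff_one, if_neg (Ne.symm h)] at hm
        exact absurd rfl hm
    · intro x
      obtain ⟨f, rfl⟩ := Ideal.Quotient.mk_surjective x
      exact ⟨fun _ => f, rfl⟩
    · rw [LinearMap.ker_comp, Submodule.ker_mkQ]

end Existence

/-- Every quotient of `k[x₁, …, xₙ]` by a homogeneous ideal has a minimal graded free
resolution. -/
theorem nonempty_minimalGradedFreeResolution {n : ℕ} {k : Type*} [Field k]
    (I : HomogeneousIdeal (homogeneousSubmodule (Fin n) k)) :
    Nonempty (MinimalGradedFreeResolution I.toIdeal) := by
  obtain ⟨A, aug, h1, h2, h3⟩ := exists_stage_zero I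
  have hs : ∀ i, ∃ g : Fin (A.iter (i + 1)).r → Fin (A.iter i).r → MvPolynomial (Fin n) k,
      Gens (A.iter i).s (A.iter i).N (A.iter (i + 1)).r (A.iter (i + 1)).s g ∧
      (A.iter (i + 1)).N = LinearMap.ker (lin g) := fun i => (A.iter i).next_spec
  choose g hg hk using hs
  have hrange : ∀ i, LinearMap.range (lin (g i)) = (A.iter i).N := fun i => by
    rw [lin, Fintype.range_linearCombination]
    exact (hg i).2
  exact ⟨{
    rank := fun i => (A.iter i).r
    shift := fun i => (A.iter i).s
    aug := aug
    diff := fun i => lin (g i)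
    aug_homog := h1
    diff_homog := fun i b a => by
      rw [lin_single]
      exact (hg i).1 b a
    aug_surjective := h2
    exact_aug := LinearMap.exact_iff.2 (h3.trans (hrange 0).symm)
    exact_diff := fun i => LinearMap.exact_iff.2 ((hk i).symm.trans (hrange (i + 1)).symm)
    minimal := fun i b a => by
      have h4 : lin (g i) (Pi.single b 1) ∈ (A.iter i).N := by
        rw [← hrange i]
        exact ⟨_, rfl⟩
      have h5 := (A.iter i).small _ h4 a
      rw [← pow_one (idealOfVars (Fin n) k), mem_pow_idealOfVars_iff']
      intro x hx
      obtain rfl : x = 0 := by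
        rw [← Finsupp.degree_eq_zero_iff]
        omega
      exact h5 }⟩

/-- The graded Betti number `β_{i,j}` of `R/I`: the number of basis elements of degree `j` in
the `i`-th free module of the minimal graded free resolution of `R/I` (which is unique up to
isomorphism, so that the chosen resolution does not matter). -/
noncomputable def gradedBetti {n : ℕ} {k : Type*} [Field k]
    (I : HomogeneousIdeal (homogeneousSubmodule (Fin n) k)) (i : ℕ) (j : ℤ) : ℕ :=
  (nonempty_minimalGradedFreeResolution I).some.betti i j

/-- The maximal shift `M_i = max {j : β_{i,j}(R/I) ≠ 0}`; the set has to be nonempty for this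
to be meaningful (it is always finite). -/
noncomputable def maxShift {n : ℕ} {k : Type*} [Field k]
    (I : HomogeneousIdeal (homogeneousSubmodule (Fin n) k)) (i : ℕ) : ℤ :=
  sSup {j : ℤ | gradedBetti I i j ≠ 0}

/-- The truncation `I_{≥ d}`: the ideal generated by the homogeneous elements of `I` of degree
at least `d`. -/
noncomputable def truncation {n : ℕ} {k : Type*} [Field k]
    (I : HomogeneousIdeal (homogeneousSubmodule (Fin n) k)) (d : ℕ) :
    HomogeneousIdeal (homogeneousSubmodule (Fin n) k) where
  toSubmodule := Ideal.span {f | f ∈ I.toIdeal ∧ ∃ e, d ≤ e ∧ f.IsHomogeneous e}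
  is_homogeneous' := Ideal.homogeneous_span _ _ fun _ ⟨_, e, _, h⟩ => ⟨e, h⟩

/-- `I` has a minimal generator of degree `e`: some homogeneous element of `I` of degree `e`
does not lie in `(x₁, …, xₙ) I`. -/
def HasMinimalGenerator {n : ℕ} {k : Type*} [Field k]
    (I : HomogeneousIdeal (homogeneousSubmodule (Fin n) k)) (e : ℕ) : Prop :=
  ∃ f ∈ I.toIdeal, f.IsHomogeneous e ∧ f ∉ idealOfVars (Fin n) k * I.toIdeal

/-- A Noetherian ring is Cohen–Macaulay if the maximal ideal of each of its localizations `A_p`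
at a prime `p` contains a regular sequence of length `dim A_p`. -/
def IsCohenMacaulay (A : Type*) [CommRing A] : Prop :=
  IsNoetherianRing A ∧ ∀ (p : Ideal A) [p.IsPrime],
    ∃ rs : List (Localization.AtPrime p),
      (∀ x ∈ rs, x ∈ IsLocalRing.maximalIdeal (Localization.AtPrime p)) ∧
      RingTheory.Sequence.IsRegular (Localization.AtPrime p) rs ∧
      (rs.length : WithBot ℕ∞) = ringKrullDim (Localization.AtPrime p)

end TruncBetti

/-! Let `J` be the truncation of `I`, and let `F`, `G` be minimal resolutions of `R/I`, `R/J`. The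
surjection `R/J → R/I` has kernel `I/J`, which lives in degrees below `d`. Lift it to a graded chain
map `φ : G → F`. The mapping cone, with `i`-th module `F_{i+1} ⊕ G_i` and augmented to `F_0`, has no
homology except `I/J` at `F_1 ⊕ G_0`, so it is exact at spot `i` in degrees at least `d + i`.
Killing the variables one at a time preserves this bound (`exactMod_of_exact`). Modulo all variables
the differentials of `F` and `G` vanish and only `φ` survives, so in degree `j ≥ d + i` exactness
says that `φ_i ⊗ k` is injective and `φ_{i+1} ⊗ k` is surjective (`cone_exactMod`,
`betti_comparison`). This gives equality in rows `d` and higher, and also `β(R/I) ≤ β(R/J)` in row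
`d - 1`.

For the maxima it remains to see that the top shift of `R/I` lies in row `d - 1` or higher. A
minimal generator of degree `D ≥ d` gives a shift `D` in `F_1`, and up to the codimension every
shift is exceeded by one in the next module (`exists_shift_succ_gt`). Otherwise a coordinate
functional of `F_{i+1}` would be a cocycle of `Hom(F, R)`; since `Ext^{i+1}(R/I, R) = 0` below the
height of `I`, it would be a coboundary, hence by minimality take values in the maximal ideal,
although it takes the value `1`. The vanishing needs a regular sequence in `I` as long as its height
(`exists_isWeaklyRegular_of_le_height`), obtained by Nagata's change of variables. -/

namespace TruncBetti

/-! ### Heights and regular sequences in `A[X]` in the presence of a monic polynomial. -/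

section RegularSequences

open Polynomial

/-- `A[X]/(f)` is integral over `A`. So a prime `Q` minimal over the contraction of `I` lifts to a
prime `P ⊇ I`. If `Q` is minimal over an ideal with `ht Q` generators, incomparability makes `P`
minimal over these generators together with `f`, and Krull's height theorem bounds `ht P`. -/
theorem height_le_height_comap_C_add_one {A : Type*} [CommRing A] [IsNoetherianRing A]
    (I : Ideal A[X]) {f : A[X]} (hf : f.Monic) (hfI : f ∈ I) :
    I.height ≤ (I.comap C).height + 1 := by
  classical
  rw [← tsub_le_iff_right, (I.comap C).height_eq_inf_minimalPrimes]
  refine le_iInf₂ fun Q hQ => ?_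
  rw [tsub_le_iff_right]
  have hQp : Q.IsPrime := hQ.1.1
  let B := A[X] ⧸ Ideal.span {f}
  have hint : Algebra.IsIntegral A B :=
    ⟨hf.quotient_isIntegral (Ideal.mem_span_singleton_self f)⟩
  have hcomap : ∀ K : Ideal B, K.comap (algebraMap A B) =
      (K.comap (Ideal.Quotient.mk (Ideal.span {f}))).comap C := fun K => rfl
  have hspan : Ideal.span {f} ≤ I := (Ideal.span_singleton_le_iff_mem I).2 hfI
  obtain ⟨P', hP'1, hP'2, hP'3⟩ := Ideal.exists_ideal_over_prime_of_isIntegral Q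
    (I.map (Ideal.Quotient.mk (Ideal.span {f}))) (by
      rw [hcomap, Ideal.comap_map_of_surjective _ Ideal.Quotient.mk_surjective,
        ← RingHom.ker_eq_comap_bot, Ideal.mk_ker, sup_eq_left.2 hspan]
      exact hQ.1.2)
  set P : Ideal A[X] := P'.comap (Ideal.Quotient.mk (Ideal.span {f})) with hP
  have hPp : P.IsPrime := Ideal.comap_isPrime _ _
  have hIP : I ≤ P := Ideal.map_le_iff_le_comap.1 hP'1
  have hPQ : P.comap C = Q := by rw [← hP'3, hcomap]
  obtain ⟨s, hs, hcard⟩ := Q.exists_finset_card_eq_height_of_isNoetherianRing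
  refine (Ideal.height_mono hIP).trans ?_
  have hmin : P ∈ (Ideal.span ((insert f (s.image C) : Finset A[X]) : Set A[X])).minimalPrimes := by
    refine ⟨⟨hPp, ?_⟩, ?_⟩
    · rw [Ideal.span_le]
      intro x hx
      simp only [Finset.coe_insert, Finset.coe_image, Set.mem_insert_iff, Set.mem_image] at hx
      rcases hx with rfl | ⟨a, ha, rfl⟩
      · exact hIP hfI
      · have : a ∈ P.comap C := hPQ ▸ hs.1.2 (Ideal.subset_span ha)
        exact this
    · rintro K ⟨hK, hsK⟩ hKP
      rw [Ideal.span_le] at hsK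
      have hQK : Q ≤ K.comap C := hs.2 ⟨Ideal.comap_isPrime _ _, by
        rw [Ideal.span_le]
        intro a ha
        exact hsK (Finset.mem_coe.2 (Finset.mem_insert_of_mem (Finset.mem_image_of_mem C ha)))⟩ (by
          rw [← hPQ]; exact Ideal.comap_mono hKP)
      have hfK : Ideal.span {f} ≤ K :=
        (Ideal.span_singleton_le_iff_mem K).2 (hsK (by simp))
      have hKc : (K.map (Ideal.Quotient.mk (Ideal.span {f}))).comap
          (Ideal.Quotient.mk (Ideal.span {f})) = K := by
        rw [Ideal.comap_map_of_surjective _ Ideal.Quotient.mk_surjective,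
          ← RingHom.ker_eq_comap_bot, Ideal.mk_ker, sup_eq_left.2 hfK]
      have hK' : (K.map (Ideal.Quotient.mk (Ideal.span {f}))).IsPrime :=
        Ideal.map_isPrime_of_surjective Ideal.Quotient.mk_surjective (by rwa [Ideal.mk_ker])
      have hle : K.map (Ideal.Quotient.mk (Ideal.span {f})) ≤ P' :=
        Ideal.map_le_iff_le_comap.2 hKP
      rcases hle.lt_or_eq with hlt | heq
      · have h1 := Ideal.IsIntegral.comap_lt_comap (R := A) hlt
        rw [hcomap, hKc, hP'3] at h1
        exact absurd hQK h1.not_ge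
      · rw [hP, ← heq, hKc]
  refine (Ideal.height_le_card_of_mem_minimalPrimes_span_finset hmin).trans ?_
  rw [← hcard]
  have h1 : (insert f (s.image C) : Finset A[X]).card ≤ s.card + 1 :=
    (Finset.card_insert_le _ _).trans (Nat.add_le_add_right Finset.card_image_le 1)
  exact_mod_cast h1

open RingTheory.Sequence in
-- Since `f` is monic, `A[X]/(f)` is free over `A`, and tensoring with a flat module preserves weak
-- regularity.
theorem isWeaklyRegular_cons_map_C {A : Type*} [CommRing A] {f : A[X]} (hf : f.Monic)
    {rs : List A} (hrs : IsWeaklyRegular A rs) : IsWeaklyRegular A[X] (f :: rs.map C) := by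
  rw [isWeaklyRegular_cons_iff]
  refine ⟨?_, ?_⟩
  · intro a b hab
    exact hf.isRegular.left hab
  · have e : QuotSMulTop f A[X] ≃ₗ[A[X]] A[X] ⧸ Ideal.span {f} :=
      Submodule.quotEquivOfEq _ _ (by
        rw [← Submodule.ideal_span_singleton_smul]; simp)
    rw [e.isWeaklyRegular_congr]
    change IsWeaklyRegular (A[X] ⧸ Ideal.span {f}) (rs.map (algebraMap A A[X]))
    rw [isWeaklyRegular_map_algebraMap_iff]
    have := hf.free_quotient
    have h1 := hrs.isWeaklyRegular_lTensor (M₂ := A[X] ⧸ Ideal.span {f})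
    exact ((TensorProduct.rid A (A[X] ⧸ Ideal.span {f})).isWeaklyRegular_congr rs).1 h1

end RegularSequences

/-! ### Nagata's change of variables over an arbitrary field. -/

section Nagata

open Polynomial MvPolynomial Nat List

variable {k : Type*} [Field k] {n : ℕ}

/-- The substitution `X₀ ↦ X₀`, `Xᵢ ↦ Xᵢ + c X₀ ^ (b ^ i)`. -/
noncomputable def nagataHom (b : ℕ) (c : k) :
    MvPolynomial (Fin (n + 1)) k →ₐ[k] MvPolynomial (Fin (n + 1)) k :=
  aeval fun i => if i = 0 then X 0 else X i + c • X 0 ^ b ^ i.1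

theorem nagataHom_comp_neg (b : ℕ) (c : k) :
    (nagataHom (n := n) b c).comp (nagataHom b (-c)) = AlgHom.id _ _ := by
  rw [nagataHom, nagataHom, comp_aeval, ← MvPolynomial.aeval_X_left]
  congr 1
  funext i
  cases i using Fin.cases <;> simp [Fin.succ_ne_zero]

/-- Nagata's change of variables. -/
noncomputable def nagataEquiv (b : ℕ) :
    MvPolynomial (Fin (n + 1)) k ≃ₐ[k] MvPolynomial (Fin (n + 1)) k :=
  AlgEquiv.ofAlgHom (nagataHom b 1) (nagataHom b (-1)) (nagataHom_comp_neg b 1)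
    (by simpa using nagataHom_comp_neg (k := k) (n := n) b (-1))

/-- Uniqueness of base `b` digits; it makes distinct monomials acquire distinct degrees in `X 0`. -/
theorem sum_pow_mul_ne {b : ℕ} (hb : 1 < b) {v w : Fin (n + 1) →₀ ℕ} (hv : ∀ i, v i < b)
    (hw : ∀ i, w i < b) (ne : v ≠ w) :
    ∑ x : Fin (n + 1), b ^ x.1 * v x ≠ ∑ x : Fin (n + 1), b ^ x.1 * w x := by
  intro h
  refine ne <| Finsupp.ext <| congrFun <| ofFn_inj.mp ?_
  apply ofDigits_inj_of_len_eq hb (by simp) ((List.forall_mem_ofFn_iff (P := (· < b))).2 hv)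
    ((List.forall_mem_ofFn_iff (P := (· < b))).2 hw)
  simpa only [ofDigits_eq_sum_mapIdx, mapIdx_eq_ofFn, get_ofFn, length_ofFn,
    Fin.val_cast, mul_comm, sum_ofFn] using! h

theorem finSuccEquiv_nagataEquiv_X {b : ℕ} (hb : 0 < b) (i : Fin (n + 1)) :
    (finSuccEquiv k n (nagataEquiv b (X i))).leadingCoeff = 1 ∧
      (finSuccEquiv k n (nagataEquiv b (X i))).natDegree = b ^ i.1 := by
  have hb' : ∀ m, 0 < b ^ m := fun m => pow_pos hb m
  cases i using Fin.cases with
  | zero => simp [nagataEquiv, nagataHom, finSuccEquiv_X_zero]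
  | succ i =>
    simp [nagataEquiv, nagataHom, finSuccEquiv_X_zero, finSuccEquiv_X_succ, Fin.succ_ne_zero,
      add_comm (Polynomial.C _)]
    exact leadingCoeff_X_pow_add_C (hb' _)

theorem finSuccEquiv_nagataEquiv_monomial {b : ℕ} (hb : 0 < b) (v : Fin (n + 1) →₀ ℕ) {a : k}
    (ha : a ≠ 0) :
    (finSuccEquiv k n (nagataEquiv b (monomial v a))).leadingCoeff = MvPolynomial.C a ∧
      (finSuccEquiv k n (nagataEquiv b (monomial v a))).natDegree =
        ∑ x : Fin (n + 1), b ^ x.1 * v x := by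
  have hC : finSuccEquiv k n (nagataEquiv b (MvPolynomial.C a)) =
      Polynomial.C (MvPolynomial.C a) := by
    simp [nagataEquiv, nagataHom, finSuccEquiv_apply]
  rw [monomial_eq, Finsupp.prod_fintype _ _ (fun i => pow_zero _)]
  simp only [map_mul, map_prod, map_pow, hC]
  have hne : ∀ i, finSuccEquiv k n (nagataEquiv b (X i)) ^ v i ≠ 0 := fun i => by
    refine pow_ne_zero _ fun h => ?_
    have := (finSuccEquiv_nagataEquiv_X (k := k) hb i).1
    rw [h] at this
    simp at this
  constructor
  · simp [leadingCoeff_prod, (finSuccEquiv_nagataEquiv_X (k := k) hb _).1]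
  · rw [natDegree_mul (by simpa using ha) (Finset.prod_ne_zero_iff.2 fun i _ => hne i),
      natDegree_prod _ _ fun i _ => hne i]
    simp [(finSuccEquiv_nagataEquiv_X (k := k) hb _).2, mul_comm]

/-- After the substitution each monomial of `f` has a constant leading coefficient in `X 0`, and the
degrees are pairwise distinct, so the leading term of largest degree cannot cancel. -/
theorem exists_algEquiv_isUnit_leadingCoeff {f : MvPolynomial (Fin (n + 1)) k} (hf : f ≠ 0) :
    ∃ e : MvPolynomial (Fin (n + 1)) k ≃ₐ[k] (MvPolynomial (Fin n) k)[X],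
      IsUnit (e f).leadingCoeff := by
  classical
  -- This exceeds every exponent occurring in `f`, and exceeds `1` even when `f` is constant.
  set b := 2 + f.totalDegree with hb
  refine ⟨(nagataEquiv b).trans (finSuccEquiv k n), ?_⟩
  set T := fun p => finSuccEquiv k n (nagataEquiv b p) with hT
  change IsUnit (T f).leadingCoeff
  have hmon : ∀ v ∈ f.support, (T (monomial v (coeff v f))).leadingCoeff =
      MvPolynomial.C (coeff v f) ∧ (T (monomial v (coeff v f))).natDegree =
        ∑ x : Fin (n + 1), b ^ x.1 * v x := fun v hv =>
    finSuccEquiv_nagataEquiv_monomial (by omega) v (mem_support_iff.1 hv)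
  have hlt : ∀ v ∈ f.support, ∀ i, v i < b := fun v hv i =>
    ((monomial_le_degreeOf i hv).trans (degreeOf_le_totalDegree f i)).trans_lt (by omega)
  obtain ⟨v, hv, hmax⟩ := Finset.exists_max_image f.support
    (fun v => ∑ x : Fin (n + 1), b ^ x.1 * v x) (support_nonempty.2 hf)
  have hv0 : T (monomial v (coeff v f)) ≠ 0 := fun h => by
    have := (hmon v hv).1
    rw [h] at this
    simp only [Polynomial.leadingCoeff_zero] at this
    exact mem_support_iff.1 hv ((map_eq_zero MvPolynomial.C).1 this.symm)
  have hsum : T f = T (monomial v (coeff v f)) +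
      ∑ w ∈ f.support.erase v, T (monomial w (coeff w f)) := by
    rw [Finset.add_sum_erase _ (fun w => T (monomial w (coeff w f))) hv]
    conv_lhs => rw [← f.support_sum_monomial_coeff]
    simp only [hT, map_sum]
  have hdeg : (∑ w ∈ f.support.erase v, T (monomial w (coeff w f))).degree <
      (T (monomial v (coeff v f))).degree := by
    refine (degree_sum_le _ _).trans_lt ((Finset.sup_lt_iff (bot_lt_iff_ne_bot.2 fun h =>
      hv0 (degree_eq_bot.1 h))).2 fun w hw => ?_)
    rw [Finset.mem_erase] at hw
    refine degree_lt_degree ?_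
    rw [(hmon w hw.2).2, (hmon v hv).2]
    exact (hmax w hw.2).lt_of_ne (sum_pow_mul_ne (by omega) (hlt w hw.2) (hlt v hv) hw.1)
  rw [hsum, leadingCoeff_add_of_degree_lt' hdeg, (hmon v hv).1]
  exact (mem_support_iff.1 hv).isUnit.map MvPolynomial.C

end Nagata

/-! ### Ideals of a polynomial ring contain regular sequences as long as their height. -/

section Grade

open Polynomial RingTheory.Sequence

/-- Induction on the number of variables: make a nonzero element of `I` monic in one variable,
contract to the remaining ones, which costs at most one in height, and put the monic element in
front of the sequence found there. -/
theorem exists_isWeaklyRegular_of_le_height {k : Type*} [Field k] (n : ℕ)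
    (I : Ideal (MvPolynomial (Fin n) k)) (hI : I ≠ ⊤) (h : ℕ) (hh : (h : ℕ∞) ≤ I.height) :
    ∃ rs : List (MvPolynomial (Fin n) k), rs.length = h ∧ (∀ r ∈ rs, r ∈ I) ∧
      IsWeaklyRegular (MvPolynomial (Fin n) k) rs := by
  induction n generalizing h with
  | zero =>
    have h1 := Ideal.height_le_ringKrullDim_of_ne_top hI
    rw [MvPolynomial.ringKrullDim_of_isNoetherianRing] at h1
    have h2 : I.height ≤ 0 := by simpa using h1
    obtain rfl : h = 0 := by simpa using hh.trans h2
    exact ⟨[], rfl, by simp, .nil _ _⟩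
  | succ n ih =>
    obtain _ | h := h
    · exact ⟨[], rfl, by simp, .nil _ _⟩
    have hbot : I ≠ ⊥ := by
      rintro rfl
      simp at hh
    obtain ⟨f, hfI, hf0⟩ := Submodule.exists_mem_ne_zero_of_ne_bot hbot
    obtain ⟨e, u⟩ := exists_algEquiv_isUnit_leadingCoeff hf0
    set I' : Ideal (MvPolynomial (Fin n) k)[X] := I.comap e.symm.toRingEquiv with hI'
    set g := u.unit⁻¹.val • e f with hg
    have hgm : g.Monic := monic_of_isUnit_leadingCoeff_inv_smul u
    have hgI : g ∈ I' := by
      refine Submodule.smul_of_tower_mem _ _ ?_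
      change e.symm (e f) ∈ I
      simpa using hfI
    have hJ : I'.comap C ≠ ⊤ := fun h => hI (by
      rw [Ideal.eq_top_iff_one] at h ⊢
      simpa [hI'] using h)
    obtain ⟨rs, hlen, hmem, hreg⟩ := ih (I'.comap C) hJ h (by
      have h1 := height_le_height_comap_C_add_one I' hgm hgI
      rw [hI', RingEquiv.height_comap] at h1
      have h2 := hh.trans h1
      rw [Nat.cast_add, Nat.cast_one] at h2
      exact (ENat.add_le_add_iff_right ENat.one_ne_top).1 h2)
    have hreg' := isWeaklyRegular_cons_map_C hgm hreg
    refine ⟨(g :: rs.map C).map e.symm, by simp [hlen], ?_, ?_⟩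
    · intro r hr
      obtain ⟨p, hp, rfl⟩ := List.mem_map.1 hr
      change p ∈ I'
      rcases List.mem_cons.1 hp with rfl | hp
      · exact hgI
      · obtain ⟨q, hq, rfl⟩ := List.mem_map.1 hp
        exact hmem q hq
    · refine (AddEquiv.isWeaklyRegular_congr (e := e.symm.toRingEquiv.toAddEquiv) ?_).1 hreg'
      refine List.forall₂_map_right_iff.2 (List.forall₂_same.2 fun r _ x => ?_)
      simp

end Grade

/-! ### Vanishing of `Ext` below the length of an annihilating regular sequence. -/

section ExtVanishing

open RingTheory.Sequence
open scoped Pointwise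

theorem exists_comp_eq_of_range_le {R P M N : Type*} [CommRing R] [AddCommGroup P] [Module R P]
    [AddCommGroup M] [Module R M] [AddCommGroup N] [Module R N] [Module.Projective R P]
    (f : M →ₗ[R] N) (g : P →ₗ[R] N) (h : ∀ x, g x ∈ LinearMap.range f) :
    ∃ l : P →ₗ[R] M, f.comp l = g := by
  obtain ⟨l, hl⟩ := Module.projective_lifting_property f.rangeRestrict (g.codRestrict _ h)
    f.surjective_rangeRestrict
  refine ⟨l, ?_⟩
  ext x
  exact congrArg Subtype.val (LinearMap.congr_fun hl x)

variable {R : Type*} [CommRing R] {F : ℕ → Type*} [∀ i, AddCommGroup (F i)] [∀ i, Module R (F i)]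
  [∀ i, Module.Projective R (F i)] (d : ∀ i, F (i + 1) →ₗ[R] F i)

/-- Multiplication by `r` induces zero on the resolved module, hence is null-homotopic. Each new
component exists because `r - s d` lands in a kernel that equals the next image. -/
theorem exists_homotopy_smul (hd : ∀ i, Function.Exact (d (i + 1)) (d i)) {r : R}
    (hr : ∀ u : F 0, r • u ∈ LinearMap.range (d 0)) (i : ℕ) :
    ∃ (s : F i →ₗ[R] F (i + 1)) (t : F (i + 1) →ₗ[R] F (i + 2)),
      ∀ x, d (i + 1) (t x) + s (d i x) = r • x := by
  have key : ∀ (i : ℕ) (s : F i →ₗ[R] F (i + 1)), (∀ x, d i (s (d i x)) = r • d i x) →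
      ∃ t : F (i + 1) →ₗ[R] F (i + 2), ∀ x, d (i + 1) (t x) + s (d i x) = r • x := by
    intro i s hs
    obtain ⟨t, ht⟩ := exists_comp_eq_of_range_le (d (i + 1))
      (r • LinearMap.id - s.comp (d i)) (fun x => by
        refine (hd i _).1 ?_
        simp [hs])
    refine ⟨t, fun x => ?_⟩
    have := LinearMap.congr_fun ht x
    simp only [LinearMap.comp_apply, LinearMap.sub_apply, LinearMap.smul_apply,
      LinearMap.id_apply] at this
    rw [this, sub_add_cancel]
  induction i with
  | zero =>
    obtain ⟨s, hs⟩ := exists_comp_eq_of_range_le (d 0) (r • LinearMap.id) hr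
    have hs' : ∀ x, d 0 (s x) = r • x := fun x => LinearMap.congr_fun hs x
    obtain ⟨t, ht⟩ := key 0 s fun x => hs' _
    exact ⟨s, t, ht⟩
  | succ i ih =>
    obtain ⟨s, t, h⟩ := ih
    obtain ⟨t', ht'⟩ := key (i + 1) t fun x => by
      rw [eq_sub_of_add_eq (h (d (i + 1) x)), (hd i).apply_apply_eq_zero]
      simp
    exact ⟨t, t', ht'⟩

/-- If the free resolution `F` resolves a module killed by the weakly `N`-regular sequence `rs`,
the cohomology of `Hom(F, N)` vanishes below the length of `rs`. -/
theorem hom_exact_of_isWeaklyRegular (hd : ∀ i, Function.Exact (d (i + 1)) (d i)) {N : Type*}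
    [AddCommGroup N] [Module R N] {rs : List R} (hreg : IsWeaklyRegular N rs)
    (hrs : ∀ r ∈ rs, ∀ u : F 0, r • u ∈ LinearMap.range (d 0)) :
    (0 < rs.length → ∀ φ : F 0 →ₗ[R] N, φ.comp (d 0) = 0 → φ = 0) ∧
    ∀ i, i + 1 < rs.length → ∀ φ : F (i + 1) →ₗ[R] N, φ.comp (d (i + 1)) = 0 →
      ∃ χ : F i →ₗ[R] N, χ.comp (d i) = φ := by
  induction rs generalizing N with
  | nil => simp
  | cons r rs ih =>
    rw [isWeaklyRegular_cons_iff] at hreg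
    obtain ⟨hr, hreg⟩ := hreg
    obtain ⟨ih0, ih1⟩ := ih hreg fun r hr => hrs r (List.mem_cons_of_mem _ hr)
    have hr0 := hrs r List.mem_cons_self
    refine ⟨fun _ φ hφ => ?_, fun i hi φ hφ => ?_⟩
    · ext u
      refine hr ?_
      obtain ⟨w, hw⟩ := hr0 u
      simp only [LinearMap.zero_apply, smul_zero]
      rw [← map_smul, ← hw]
      exact LinearMap.congr_fun hφ w
    -- For a cocycle `φ` the homotopy gives `φ s d = r φ`, so `r φ` is a coboundary; the task is to
    -- divide by `r`.
    · obtain ⟨s, t, hst⟩ := exists_homotopy_smul d hd hr0 i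
      have hψ : ∀ x, φ (s (d i x)) = r • φ x := fun x => by
        rw [eq_sub_of_add_eq' (hst x), map_sub, map_smul, ← LinearMap.comp_apply, hφ]
        simp
      let q : N →ₗ[R] QuotSMulTop r N := (r • (⊤ : Submodule R N)).mkQ
      have hq : ∀ x, q x = 0 → ∃ y, r • y = x := fun x hx => by
        rw [Submodule.mkQ_apply, Submodule.Quotient.mk_eq_zero,
          Submodule.mem_smul_pointwise_iff_exists] at hx
        obtain ⟨y, -, hy⟩ := hx
        exact ⟨y, hy⟩
      have hq' : ∀ x, q (r • x) = 0 := fun x => by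
        rw [Submodule.mkQ_apply, Submodule.Quotient.mk_eq_zero]
        exact Submodule.smul_mem_pointwise_smul _ _ _ trivial
      have hqψ : (q.comp (φ.comp s)).comp (d i) = 0 := by
        ext x
        simp only [LinearMap.comp_apply, hψ, hq', LinearMap.zero_apply]
      -- Modulo `r` the map `φ s` is a cocycle with values in `N/rN`, hence zero or a coboundary by
      -- induction. Lifting the bounding map to `N` gives a cocycle `ξ` congruent to `φ s`, so that
      -- `φ s - ξ` is divisible by `r`.
      obtain ⟨ξ, hξ1, hξ2⟩ : ∃ ξ : F i →ₗ[R] N, ξ.comp (d i) = 0 ∧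
          ∀ x, q (φ (s x) - ξ x) = 0 := by
        obtain _ | i := i
        · refine ⟨0, by simp, fun x => ?_⟩
          have := ih0 (by simpa using hi) _ hqψ
          simpa using LinearMap.congr_fun this x
        · obtain ⟨χ, hχ⟩ := ih1 i (by simpa using hi) _ hqψ
          obtain ⟨χ', hχ'⟩ := Module.projective_lifting_property q χ
            (Submodule.mkQ_surjective _)
          refine ⟨χ'.comp (d i), ?_, fun x => ?_⟩
          · ext x
            simp [(hd i).apply_apply_eq_zero]
          · have h1 := LinearMap.congr_fun hχ x
            have h2 := LinearMap.congr_fun hχ' (d i x)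
            simp only [LinearMap.comp_apply] at h1 h2 ⊢
            rw [map_sub, h2, h1, sub_self]
      obtain ⟨θ, hθ⟩ := exists_comp_eq_of_range_le (r • LinearMap.id : N →ₗ[R] N)
        (φ.comp s - ξ) (fun x => by
          obtain ⟨y, hy⟩ := hq _ (hξ2 x)
          exact ⟨y, hy⟩)
      refine ⟨θ, ?_⟩
      ext x
      refine hr ?_
      have h1 := LinearMap.congr_fun hθ (d i x)
      have h2 := LinearMap.congr_fun hξ1 x
      simp only [LinearMap.comp_apply, LinearMap.smul_apply, LinearMap.id_apply,
        LinearMap.sub_apply, LinearMap.zero_apply] at h1 h2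
      rw [h2, sub_zero, hψ] at h1
      exact h1

end ExtVanishing

/-! ### Growth of the shifts up to the codimension. -/

theorem single_eq_smul {R α : Type*} [CommSemiring R] [DecidableEq α] (a : α) (x : R) :
    (Pi.single a x : α → R) = x • Pi.single a 1 := by
  rw [← Pi.single_smul, smul_eq_mul, mul_one]

open MvPolynomial in
theorem MinimalGradedFreeResolution.exists_shift_succ_gt {n : ℕ} {k : Type*} [Field k]
    {I : Ideal (MvPolynomial (Fin n) k)} (F : MinimalGradedFreeResolution I) (hI : I ≠ ⊤) {i : ℕ}
    (hi : ((i + 2 : ℕ) : ℕ∞) ≤ I.height) (a : Fin (F.rank (i + 1))) :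
    ∃ b, F.shift (i + 1) a < F.shift (i + 2) b := by
  classical
  by_contra! hle
  obtain ⟨rs, hlen, hmem, hreg⟩ := exists_isWeaklyRegular_of_le_height n I hI _ hi
  have h0 : ∀ r ∈ rs, ∀ u, r • u ∈ LinearMap.range (F.diff 0) := fun r hr u => by
    refine (F.exact_aug _).1 ?_
    rw [map_smul]
    obtain ⟨x, hx⟩ := Ideal.Quotient.mk_surjective (F.aug u)
    rw [← hx]
    change Ideal.Quotient.mk I (r * x) = 0
    exact Ideal.Quotient.eq_zero_iff_mem.2 (I.mul_mem_right _ (hmem r hr))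
  -- If no shift exceeds that of `a`, the entries in row `a` have degree at most `0`; lying in the
  -- maximal ideal, they vanish.
  have hcoc : (LinearMap.proj a : _ →ₗ[MvPolynomial (Fin n) k] _).comp (F.diff (i + 1)) = 0 := by
    refine LinearMap.pi_ext' fun b => LinearMap.ext_ring ?_
    change F.diff (i + 1) (Pi.single b 1) a = 0
    ext m
    rw [coeff_zero]
    by_contra hm
    have h1 : (m.degree : ℤ) = F.shift (i + 2) b - F.shift (i + 1) a :=
      F.diff_homog (i + 1) b a m hm
    have h2 := F.minimal (i + 1) b a
    rw [← pow_one (idealOfVars (Fin n) k), mem_pow_idealOfVars_iff'] at h2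
    have h3 := hle b
    refine hm (h2 m ?_)
    omega
  obtain ⟨χ, hχ⟩ := (hom_exact_of_isWeaklyRegular
    (F := fun i => Fin (F.rank i) → MvPolynomial (Fin n) k) F.diff F.exact_diff hreg h0).2 i
    (by omega) _ hcoc
  have h1 := LinearMap.congr_fun hχ (Pi.single a 1)
  simp only [LinearMap.comp_apply, LinearMap.proj_apply, Pi.single_eq_same] at h1
  have h2 : χ (F.diff i (Pi.single a 1)) ∈ idealOfVars (Fin n) k := by
    rw [← Finset.univ_sum_single (F.diff i (Pi.single a 1)), map_sum]
    refine Ideal.sum_mem _ fun c _ => ?_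
    rw [single_eq_smul, map_smul]
    exact Ideal.mul_mem_right _ _ (F.minimal i a c)
  rw [h1, ← pow_one (idealOfVars (Fin n) k), mem_pow_idealOfVars_iff'] at h2
  have := h2 0 (by simp)
  simp at this

/-! ### Graded components and ideals generated by variables. -/

section Components

open MvPolynomial

variable {n : ℕ} {k : Type*} [Field k]

theorem compZ_add (e : ℤ) (f g : MvPolynomial (Fin n) k) :
    compZ e (f + g) = compZ e f + compZ e g := by
  ext m
  simp only [coeff_compZ, coeff_add]
  split_ifs <;> simp

theorem compZ_neg (e : ℤ) (f : MvPolynomial (Fin n) k) : compZ e (-f) = -compZ e f := by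
  ext m
  simp only [coeff_compZ, coeff_neg]
  split_ifs <;> simp

theorem compZ_sub (e : ℤ) (f g : MvPolynomial (Fin n) k) :
    compZ e (f - g) = compZ e f - compZ e g := by
  rw [sub_eq_add_neg, compZ_add, compZ_neg, ← sub_eq_add_neg]

theorem compZ_eq_self_iff {e : ℤ} {f : MvPolynomial (Fin n) k} :
    compZ e f = f ↔ IntHomog f e := by
  constructor
  · intro h m hm
    rw [← h, coeff_compZ] at hm
    by_contra hme
    exact hm (if_neg hme)
  · intro h
    ext m
    rw [coeff_compZ]
    by_cases hm : coeff m f = 0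
    · simp [hm]
    · rw [if_pos (h m hm)]

theorem compZ_compZ (e : ℤ) (f : MvPolynomial (Fin n) k) : compZ e (compZ e f) = compZ e f := by
  ext m
  simp only [coeff_compZ]
  split_ifs <;> rfl

theorem compZ_zero_one : compZ 0 (1 : MvPolynomial (Fin n) k) = 1 :=
  compZ_eq_self_iff.2 fun m hm => by
    classical
    rw [coeff_one] at hm
    split_ifs at hm with h0
    · simp [← h0]
    · exact absurd rfl hm

theorem compZ_X_mul (e : ℤ) (v : Fin n) (f : MvPolynomial (Fin n) k) :
    compZ e (X v * f) = X v * compZ (e - 1) f := by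
  have h := compZ_mul (e - 1) 1 f (X v) (fun m hm => by
    classical
    rw [coeff_X] at hm
    split_ifs at hm with h
    · simp [← h]
    · exact absurd rfl hm)
  rw [sub_add_cancel] at h
  rw [mul_comm, h, mul_comm]

/-- The ideal generated by the variables with index in `S`. -/
noncomputable def varIdeal (k : Type*) [Field k] (S : Finset (Fin n)) :
    Ideal (MvPolynomial (Fin n) k) :=
  Ideal.span (X '' (S : Set (Fin n)))

theorem mem_varIdeal {S : Finset (Fin n)} {f : MvPolynomial (Fin n) k} :
    f ∈ varIdeal k S ↔ ∀ m, coeff m f ≠ 0 → ∃ i ∈ S, m i ≠ 0 := by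
  simp [varIdeal, mem_ideal_span_X_image]

theorem mem_varIdeal_univ {f : MvPolynomial (Fin n) k} :
    f ∈ varIdeal k Finset.univ ↔ constantCoeff f = 0 := by
  rw [mem_varIdeal, constantCoeff_eq]
  constructor
  · intro h
    by_contra h0
    obtain ⟨i, -, hi⟩ := h 0 h0
    exact hi rfl
  · intro h m hm
    by_contra! h0
    obtain rfl : m = 0 := Finsupp.ext fun i => h0 i (Finset.mem_univ i)
    exact hm h

theorem varIdeal_univ : varIdeal k (Finset.univ : Finset (Fin n)) = idealOfVars (Fin n) k := by
  simp [varIdeal, idealOfVars]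

theorem compZ_mem_varIdeal {S : Finset (Fin n)} {f : MvPolynomial (Fin n) k}
    (hf : f ∈ varIdeal k S) (e : ℤ) : compZ e f ∈ varIdeal k S := by
  rw [mem_varIdeal] at hf ⊢
  intro m hm
  rw [coeff_compZ] at hm
  split_ifs at hm with h
  · exact hf m hm
  · exact absurd rfl hm

theorem mem_varIdeal_of_X_mul_mem {S : Finset (Fin n)} {v : Fin n} (hv : v ∉ S)
    {f : MvPolynomial (Fin n) k} (hf : X v * f ∈ varIdeal k S) : f ∈ varIdeal k S := by
  rw [mem_varIdeal] at hf ⊢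
  intro m hm
  obtain ⟨i, hi, him⟩ := hf (Finsupp.single v 1 + m) (by rwa [coeff_X_mul])
  refine ⟨i, hi, ?_⟩
  have hvi : v ≠ i := fun h => hv (h ▸ hi)
  simpa [Finsupp.single_apply, hvi] using him

theorem exists_eq_X_mul_add {S : Finset (Fin n)} {v : Fin n} {f : MvPolynomial (Fin n) k}
    (hf : f ∈ varIdeal k (insert v S)) : ∃ q, ∃ w ∈ varIdeal k S, f = X v * q + w := by
  rw [varIdeal, Finset.coe_insert, Set.image_insert_eq, Ideal.mem_span_insert] at hf
  obtain ⟨q, w, hw, rfl⟩ := hf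
  exact ⟨q, w, hw, by rw [mul_comm]⟩

theorem varIdeal_mono {S T : Finset (Fin n)} (h : S ⊆ T) : varIdeal k S ≤ varIdeal k T :=
  Ideal.span_mono (Set.image_mono h)

theorem X_mem_varIdeal {S : Finset (Fin n)} {v : Fin n} (h : v ∈ S) : X v ∈ varIdeal k S :=
  Ideal.subset_span ⟨v, h, rfl⟩

/-- The component of degree `e` of an element of the free module with shifts `s`. -/
noncomputable def compV {α : Type*} (s : α → ℤ) (e : ℤ) (v : α → MvPolynomial (Fin n) k) :
    α → MvPolynomial (Fin n) k := fun a => compZ (e - s a) (v a)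

theorem compV_sub {α : Type*} (s : α → ℤ) (e : ℤ) (v w : α → MvPolynomial (Fin n) k) :
    compV s e (v - w) = compV s e v - compV s e w :=
  funext fun _ => compZ_sub _ _ _

theorem compV_add {α : Type*} (s : α → ℤ) (e : ℤ) (v w : α → MvPolynomial (Fin n) k) :
    compV s e (v + w) = compV s e v + compV s e w :=
  funext fun _ => compZ_add _ _ _

theorem compV_compV {α : Type*} (s : α → ℤ) (e : ℤ) (v : α → MvPolynomial (Fin n) k) :
    compV s e (compV s e v) = compV s e v :=
  funext fun _ => compZ_compZ _ _

theorem compV_X_smul {α : Type*} (s : α → ℤ) (e : ℤ) (x : Fin n)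
    (v : α → MvPolynomial (Fin n) k) :
    compV s e ((X x : MvPolynomial (Fin n) k) • v) =
      (X x : MvPolynomial (Fin n) k) • compV s (e - 1) v := by
  funext a
  simp only [compV, Pi.smul_apply, smul_eq_mul, compZ_X_mul]
  congr 2
  ring

theorem compV_sumElim {α β : Type*} (s : α → ℤ) (t : β → ℤ) (e : ℤ)
    (v : α → MvPolynomial (Fin n) k) (w : β → MvPolynomial (Fin n) k) :
    compV (Sum.elim s t) e (Sum.elim v w) = Sum.elim (compV s e v) (compV t e w) := by
  funext a
  cases a <;> rfl

theorem compV_single_one {α : Type*} [DecidableEq α] (s : α → ℤ) (b : α) :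
    compV s (s b) (Pi.single b 1) = (Pi.single b 1 : α → MvPolynomial (Fin n) k) := by
  funext a
  by_cases hab : a = b
  · subst hab
    simp only [compV, Pi.single_eq_same, sub_self, compZ_zero_one]
  · simp only [compV, Pi.single_eq_of_ne hab]
    ext m
    simp [coeff_compZ]

theorem compV_map {r m : ℕ} {s : Fin r → ℤ} {t : Fin m → ℤ}
    {f : (Fin m → MvPolynomial (Fin n) k) →ₗ[MvPolynomial (Fin n) k]
      (Fin r → MvPolynomial (Fin n) k)}
    (hf : ∀ b, VecHomog s (f (Pi.single b 1)) (t b)) (e : ℤ)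
    (c : Fin m → MvPolynomial (Fin n) k) : compV s e (f c) = f (compV t e c) := by
  have h : f = lin fun b => f (Pi.single b 1) :=
    LinearMap.pi_ext' fun b => LinearMap.ext_ring (by
      simp only [LinearMap.comp_apply, LinearMap.single_apply, lin_single])
  rw [h]
  exact comp_lin s t _ hf e c

end Components

/-! ### Exactness in high degrees modulo the variables. -/

section Exactness

open MvPolynomial

variable {n : ℕ} {k : Type*} [Field k]

local notation "R" => MvPolynomial (Fin n) k

/-- The complex `A → B → C` of free modules, reduced modulo the variables in `S`, is exact at
`B` in degree `j`. -/
def ExactMod {α β γ : Type*} (S : Finset (Fin n)) (s : β → ℤ)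
    (f : (α → R) →ₗ[R] (β → R)) (g : (β → R) →ₗ[R] (γ → R)) (j : ℤ) : Prop :=
  ∀ c, compV s j c = c → (∀ a, g c a ∈ varIdeal k S) → ∃ e, ∀ a, (c - f e) a ∈ varIdeal k S

/-- The long exact sequence of multiplication by the nonzerodivisor `X v`, in elements: a cycle `c`
modulo `insert v S` has `g c = X v * q + w` with `w` zero modulo `S`. Then `q` is a cycle modulo `S`
of degree `j - 1`, so `q ≡ g p`, and `c - X v * p` is a cycle modulo `S` in degree `j`. -/
theorem ExactMod.insert {α β γ δ : Type*} [Finite γ] [Finite β] {S : Finset (Fin n)} {v : Fin n}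
    (hv : v ∉ S) {s : β → ℤ} {t : γ → ℤ}
    {f : (α → R) →ₗ[R] (β → R)} {g : (β → R) →ₗ[R] (γ → R)} {h : (γ → R) →ₗ[R] (δ → R)}
    (hg : ∀ e c, compV t e (g c) = g (compV s e c)) (hgh : ∀ c, h (g c) = 0) {j : ℤ}
    (h1 : ExactMod S t g h (j - 1)) (h2 : ExactMod S s f g j) :
    ExactMod (insert v S) s f g j := by
  intro c hc hgc
  choose q₀ w₀ hw₀ hqw₀ using fun a => exists_eq_X_mul_add (hgc a)
  have heq : g c = (X v : R) • compV t (j - 1) q₀ + compV t j w₀ := by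
    rw [← compV_X_smul, ← compV_add, ← hc, ← hg]
    congr 1
    funext a
    exact hqw₀ a
  have hw : ∀ a, compV t j w₀ a ∈ varIdeal k S := fun a => compZ_mem_varIdeal (hw₀ a) _
  generalize hq' : compV t (j - 1) q₀ = q at heq
  generalize compV t j w₀ = w at heq hw
  have hq : compV t (j - 1) q = q := by rw [← hq', compV_compV]
  have hhq : ∀ a, h q a ∈ varIdeal k S := fun a => by
    refine mem_varIdeal_of_X_mul_mem hv ?_
    have h3 := hgh c
    rw [heq, map_add, map_smul] at h3
    have h4 : X v * h q a = - h w a := eq_neg_of_add_eq_zero_left (congrFun h3 a)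
    rw [h4]
    exact neg_mem (Ideal.map_pi _ w hw h a)
  obtain ⟨p, hp⟩ := h1 q hq hhq
  have hp' : ∀ a, (q - g (compV s (j - 1) p)) a ∈ varIdeal k S := fun a => by
    rw [← hg, ← hq, ← compV_sub]
    exact compZ_mem_varIdeal (hp a) _
  obtain ⟨e, he⟩ := h2 (c - (X v : R) • compV s (j - 1) p)
    (by rw [compV_sub, compV_X_smul, compV_compV, hc]) (fun a => by
      have h3 : g (c - (X v : R) • compV s (j - 1) p) =
          (X v : R) • (q - g (compV s (j - 1) p)) + w := by
        rw [map_sub, map_smul, heq, smul_sub]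
        abel
      rw [h3]
      exact add_mem (Ideal.mul_mem_left _ _ (hp' a)) (hw a))
  refine ⟨e, fun a => ?_⟩
  have h3 : (c - f e) a = (c - (X v : R) • compV s (j - 1) p - f e) a +
      X v * compV s (j - 1) p a := by
    simp only [Pi.sub_apply, Pi.smul_apply, smul_eq_mul]
    ring
  rw [h3]
  exact add_mem (varIdeal_mono (Finset.subset_insert v S) (he a))
    (Ideal.mul_mem_right _ _ (X_mem_varIdeal (Finset.mem_insert_self v S)))

/-- If a complex `⋯ → C₁ → C₀ → E → 0` of graded free modules is exact at `E`, and at `Cᵢ` in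
degrees at least `i + q`, then the same holds modulo the variables. -/
theorem exactMod_of_exact {ι : ℕ → Type*} [∀ i, Finite (ι i)] {κ : Type*} [Finite κ]
    {s : ∀ i, ι i → ℤ} {t : κ → ℤ} {d : ∀ i, (ι (i + 1) → R) →ₗ[R] (ι i → R)}
    {ε : (ι 0 → R) →ₗ[R] (κ → R)}
    (hd : ∀ i e c, compV (s i) e (d i c) = d i (compV (s (i + 1)) e c))
    (hε : ∀ e c, compV t e (ε c) = ε (compV (s 0) e c))
    (hdd : ∀ i c, d i (d (i + 1) c) = 0) (hεd : ∀ c, ε (d 0 c) = 0)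
    (hsurj : Function.Surjective ε) (q : ℤ)
    (hex0 : ∀ j, q ≤ j → ∀ c, compV (s 0) j c = c → ε c = 0 → ∃ e, d 0 e = c)
    (hex : ∀ i j, q + (i + 1 : ℕ) ≤ j → ∀ c, compV (s (i + 1)) j c = c → d i c = 0 →
      ∃ e, d (i + 1) e = c) (S : Finset (Fin n)) :
    (∀ j, q ≤ j → ExactMod S (s 0) (d 0) ε j) ∧
    ∀ i j, q + (i + 1 : ℕ) ≤ j → ExactMod S (s (i + 1)) (d (i + 1)) (d i) j := by
  induction S using Finset.induction_on with
  | empty =>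
    have h0 : ∀ f : R, f ∈ varIdeal k (∅ : Finset (Fin n)) ↔ f = 0 := fun f => by simp [varIdeal]
    constructor
    · intro j hj c hc hεc
      simp only [h0] at hεc
      obtain ⟨e, rfl⟩ := hex0 j hj c hc (funext hεc)
      exact ⟨e, fun a => by simp⟩
    · intro i j hj c hc hdc
      simp only [h0] at hdc
      obtain ⟨e, rfl⟩ := hex i j hj c hc (funext hdc)
      exact ⟨e, fun a => by simp⟩
  | insert v S hv ih =>
    obtain ⟨ih0, ih1⟩ := ih
    refine ⟨fun j hj => ?_, fun i j hj => ?_⟩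
    -- The complex ends in `E → 0`, and surjectivity of `ε` gives exactness at `E` in every degree.
    · refine ExactMod.insert (h := (0 : (κ → R) →ₗ[R] (κ → R))) hv hε (fun c => rfl) ?_
        (ih0 j hj)
      intro c _ _
      obtain ⟨e, rfl⟩ := hsurj c
      exact ⟨e, fun a => by simp⟩
    · obtain _ | i := i
      -- The degree lost to `X v` is matched by the threshold, which drops by one at the preceding
      -- spot.
      · exact ExactMod.insert hv (hd 0) hεd (ih0 (j - 1) (by push_cast at hj; omega)) (ih1 0 j hj)
      · exact ExactMod.insert hv (hd (i + 1)) (hdd i)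
          (ih1 i (j - 1) (by push_cast at hj ⊢; omega)) (ih1 (i + 1) j hj)

end Exactness

/-! ### Chain maps between resolutions and their mapping cones. -/

section Comparison

open MvPolynomial

variable {n : ℕ} {k : Type*} [Field k]

local notation "R" => MvPolynomial (Fin n) k

theorem compZ_mem_of_isHomogeneous {I : Ideal (MvPolynomial (Fin n) k)}
    (hI : I.IsHomogeneous (homogeneousSubmodule (Fin n) k)) {f : R} (hf : f ∈ I) (e : ℤ) : compZ e f ∈ I := by
  unfold compZ
  split_ifs
  · exact (mem_iff_homogeneousComponent_mem hI f).1 hf _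
  · exact I.zero_mem

namespace MinimalGradedFreeResolution

variable {I J : Ideal (MvPolynomial (Fin n) k)}

/-- A graded lift `F₀ → R` of the augmentation `F₀ → R/I`. -/
theorem exists_lift_aug (F : MinimalGradedFreeResolution I) :
    ∃ π : (Fin (F.rank 0) → R) →ₗ[R] R,
      (∀ c : Fin (F.rank 0) → R, F.aug c = Ideal.Quotient.mk I (π c)) ∧
      ∀ (e : ℤ) (c : Fin (F.rank 0) → R), compZ e (π c) = π (compV (F.shift 0) e c) := by
  choose p hp hpa using F.aug_homog
  refine ⟨Fintype.linearCombination R p, fun c => ?_, fun e c => ?_⟩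
  · have h : F.aug = (Submodule.mkQ I).comp (Fintype.linearCombination R p) :=
      LinearMap.pi_ext' fun b => LinearMap.ext_ring (by
        classical
        simp only [LinearMap.comp_apply, LinearMap.single_apply,
          Fintype.linearCombination_apply_single, one_smul]
        exact hpa b)
    rw [h]
    rfl
  · rw [Fintype.linearCombination_apply, Fintype.linearCombination_apply, compZ_sum]
    refine Finset.sum_congr rfl fun b _ => ?_
    simp only [smul_eq_mul, compV]
    rw [← compZ_mul _ _ _ _ (hp b), sub_add_cancel]

theorem compV_diff (F : MinimalGradedFreeResolution I) (i : ℕ) (e : ℤ)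
    (c : Fin (F.rank (i + 1)) → R) :
    compV (F.shift i) e (F.diff i c) = F.diff i (compV (F.shift (i + 1)) e c) :=
  compV_map (F.diff_homog i) e c

theorem diff_mem_varIdeal (F : MinimalGradedFreeResolution I) (i : ℕ)
    (c : Fin (F.rank (i + 1)) → R) (a : Fin (F.rank i)) :
    F.diff i c a ∈ varIdeal k Finset.univ := by
  rw [varIdeal_univ, ← Finset.univ_sum_single c, map_sum, Finset.sum_apply]
  refine Ideal.sum_mem _ fun b _ => ?_
  rw [single_eq_smul, map_smul]
  exact Ideal.mul_mem_left _ _ (F.minimal i b a)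

/-- Any preimages of the images of the basis vectors may be replaced by their components of the
right degree. -/
theorem exists_graded_lift {r m l : ℕ} {s : Fin r → ℤ} {t : Fin m → ℤ} {u : Fin l → ℤ}
    {f : (Fin l → R) →ₗ[R] (Fin r → R)} (hf : ∀ e c, compV s e (f c) = f (compV u e c))
    {g : (Fin m → R) →ₗ[R] (Fin r → R)} (hg : ∀ e c, compV s e (g c) = g (compV t e c))
    (h : ∀ c, ∃ w, f w = g c) :
    ∃ ψ : (Fin m → R) →ₗ[R] (Fin l → R), (∀ e c, compV u e (ψ c) = ψ (compV t e c)) ∧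
      ∀ c, f (ψ c) = g c := by
  classical
  choose w hw using fun b => h (Pi.single b 1)
  refine ⟨lin fun b => compV u (t b) (w b), fun e c => ?_, fun c => ?_⟩
  · exact comp_lin u t _ (fun b => comp_homog u _ _) e c
  · have : f.comp (lin fun b => compV u (t b) (w b)) = g :=
      LinearMap.pi_ext' fun b => LinearMap.ext_ring (by
        simp only [LinearMap.comp_apply, LinearMap.single_apply, lin_single]
        rw [← hf, hw, hg]
        congr 1
        exact compV_single_one t b)
    exact LinearMap.congr_fun this c

/-- Comparison of graded free resolutions along `R/J → R/I`. -/
theorem exists_chainMap (F : MinimalGradedFreeResolution I) (G : MinimalGradedFreeResolution J)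
    (hI : I.IsHomogeneous (homogeneousSubmodule (Fin n) k)) (hJI : J ≤ I) :
    ∃ φ : ∀ i, (Fin (G.rank i) → R) →ₗ[R] (Fin (F.rank i) → R),
      (∀ i e c, compV (F.shift i) e (φ i c) = φ i (compV (G.shift i) e c)) ∧
      (∀ i c, F.diff i (φ (i + 1) c) = φ i (G.diff i c)) ∧
      ∀ c, F.aug (φ 0 c) = Ideal.Quotient.factor hJI (G.aug c) := by
  classical
  obtain ⟨πF, hF1, hF2⟩ := F.exists_lift_aug
  obtain ⟨πG, hG1, hG2⟩ := G.exists_lift_aug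
  have hstart : ∃ φ₀ : (Fin (G.rank 0) → R) →ₗ[R] (Fin (F.rank 0) → R),
      (∀ e c, compV (F.shift 0) e (φ₀ c) = φ₀ (compV (G.shift 0) e c)) ∧
      ∀ c, F.aug (φ₀ c) = Ideal.Quotient.factor hJI (G.aug c) := by
    choose w hw using fun b => F.aug_surjective
      (Ideal.Quotient.mk I (πG (Pi.single b 1)))
    refine ⟨lin fun b => compV (F.shift 0) (G.shift 0 b) (w b), fun e c => ?_, fun c => ?_⟩
    · exact comp_lin _ _ _ (fun b => comp_homog _ _ _) e c
    · have h1 : F.aug.comp (lin fun b => compV (F.shift 0) (G.shift 0 b) (w b)) =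
          (Submodule.mkQ I).comp πG := LinearMap.pi_ext' fun b => LinearMap.ext_ring (by
        simp only [LinearMap.comp_apply, LinearMap.single_apply, lin_single]
        rw [hF1, ← hF2]
        refine Ideal.Quotient.eq.2 ?_
        have h2 : compZ (G.shift 0 b) (πG (Pi.single b 1)) = πG (Pi.single b 1) := by
          rw [hG2]
          congr 1
          exact compV_single_one _ b
        rw [← h2, ← compZ_sub]
        refine compZ_mem_of_isHomogeneous hI (Ideal.Quotient.eq.1 ?_) _
        rw [← hF1, hw])
      rw [hG1]
      exact LinearMap.congr_fun h1 c
  obtain ⟨φ₀, h₀, haug⟩ := hstart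
  -- Each component carries the liftability condition that lets the recursion continue.
  let X : ℕ → Type _ := fun i => {ψ : (Fin (G.rank i) → R) →ₗ[R] (Fin (F.rank i) → R) //
    (∀ e c, compV (F.shift i) e (ψ c) = ψ (compV (G.shift i) e c)) ∧
    ∀ w, ∃ z, F.diff i z = ψ (G.diff i w)}
  have hnext : ∀ i (ψ : X i), ∃ ψ' : X (i + 1), ∀ c,
      F.diff i (ψ'.1 c) = ψ.1 (G.diff i c) := by
    rintro i ⟨ψ, hψ, hψ'⟩
    obtain ⟨ψ', h1, h2⟩ := exists_graded_lift (F.compV_diff i) (g := ψ.comp (G.diff i))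
      (t := G.shift (i + 1)) (fun e c => by
        simp only [LinearMap.comp_apply]
        rw [hψ, G.compV_diff]) hψ'
    refine ⟨⟨ψ', h1, fun w => (F.exact_diff i _).1 ?_⟩, h2⟩
    rw [h2, LinearMap.comp_apply, (G.exact_diff i).apply_apply_eq_zero, map_zero]
  choose nx hnx using hnext
  let φ : ∀ i, X i := fun i => Nat.rec ⟨φ₀, h₀, fun w => (F.exact_aug _).1 (by
    rw [haug, G.exact_aug.apply_apply_eq_zero, map_zero])⟩ nx i
  exact ⟨fun i => (φ i).1, fun i => (φ i).2.1, fun i => hnx i (φ i), haug⟩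

/-- The mapping cone of a comparison map `G → F` over `R/J → R/I`, where `J` and `I` agree in
degrees at least `q`, is exact in high degrees modulo the variables. -/
theorem cone_exactMod (F : MinimalGradedFreeResolution I) (G : MinimalGradedFreeResolution J)
    (hJI : J ≤ I) {q : ℤ} (hIJ : ∀ f ∈ I, ∀ j, q ≤ j → compZ j f = f → f ∈ J)
    {φ : ∀ i, (Fin (G.rank i) → R) →ₗ[R] (Fin (F.rank i) → R)}
    (hφ : ∀ i e c, compV (F.shift i) e (φ i c) = φ i (compV (G.shift i) e c))
    (hφd : ∀ i c, F.diff i (φ (i + 1) c) = φ i (G.diff i c))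
    (haug : ∀ c, F.aug (φ 0 c) = Ideal.Quotient.factor hJI (G.aug c))
    (i : ℕ) (j : ℤ) (hj : q + i ≤ j) (u : Fin (F.rank (i + 1)) → R) (v : Fin (G.rank i) → R)
    (hu : compV (F.shift (i + 1)) j u = u) (hv : compV (G.shift i) j v = v)
    (hm : ∀ a, φ i v a ∈ varIdeal k Finset.univ) :
    (∀ b, v b ∈ varIdeal k Finset.univ) ∧
      ∃ v' : Fin (G.rank (i + 1)) → R, ∀ a, (u - φ (i + 1) v') a ∈ varIdeal k Finset.univ := by
  -- The cone is indexed so that `F_0` is the target of its augmentation.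
  let ι : ℕ → Type := fun i => Fin (F.rank (i + 1)) ⊕ Fin (G.rank i)
  let s : ∀ i, ι i → ℤ := fun i => Sum.elim (F.shift (i + 1)) (G.shift i)
  let fst : ∀ i, (ι i → R) →ₗ[R] (Fin (F.rank (i + 1)) → R) := fun i =>
    LinearMap.funLeft R R Sum.inl
  let snd : ∀ i, (ι i → R) →ₗ[R] (Fin (G.rank i) → R) := fun i => LinearMap.funLeft R R Sum.inr
  have hpair : ∀ i (c : ι i → R), Sum.elim (fst i c) (snd i c) = c := fun i c =>
    Sum.elim_comp_inl_inr c
  have hfst : ∀ i e c, compV (F.shift (i + 1)) e (fst i c) = fst i (compV (s i) e c) :=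
    fun _ _ _ => rfl
  have hsnd : ∀ i e c, compV (G.shift i) e (snd i c) = snd i (compV (s i) e c) :=
    fun _ _ _ => rfl
  let D : ∀ i, (ι (i + 1) → R) →ₗ[R] (ι i → R) := fun i =>
    (LinearEquiv.sumArrowLequivProdArrow _ _ R R).symm.toLinearMap.comp
      (((F.diff (i + 1)).comp (fst (i + 1)) + (φ (i + 1)).comp (snd (i + 1))).prod
        (-(G.diff i).comp (snd (i + 1))))
  have hD1 : ∀ i c, fst i (D i c) =
      F.diff (i + 1) (fst (i + 1) c) + φ (i + 1) (snd (i + 1) c) := fun _ _ => rfl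
  have hD2 : ∀ i c, snd i (D i c) = -G.diff i (snd (i + 1) c) := fun _ _ => rfl
  have hext : ∀ i (c c' : ι i → R), fst i c = fst i c' → snd i c = snd i c' → c = c' :=
    fun i c c' h1 h2 => by rw [← hpair i c, ← hpair i c', h1, h2]
  let ε : (ι 0 → R) →ₗ[R] (Fin (F.rank 0) → R) :=
    (F.diff 0).comp (fst 0) + (φ 0).comp (snd 0)
  have hε1 : ∀ c, ε c = F.diff 0 (fst 0 c) + φ 0 (snd 0 c) := fun _ => rfl
  have hneg : ∀ i e (w : Fin (G.rank i) → R), compV (G.shift i) e (-w) = -compV (G.shift i) e w :=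
    fun i e w => funext fun _ => compZ_neg _ _
  obtain ⟨πG, hG1, hG2⟩ := G.exists_lift_aug
  have key := exactMod_of_exact (s := s) (t := F.shift 0) (d := D) (ε := ε)
    (fun i e c => by
      refine hext _ _ _ ?_ ?_
      · rw [← hfst, hD1, hD1, compV_add, F.compV_diff, hφ, hfst, hsnd]
      · rw [← hsnd, hD2, hD2, hneg, G.compV_diff, hsnd])
    (fun e c => by rw [hε1, hε1, compV_add, F.compV_diff, hφ, hfst, hsnd])
    (fun i c => by
      refine hext _ _ _ ?_ ?_
      · rw [hD1, hD1, hD2, map_add, (F.exact_diff (i + 1)).apply_apply_eq_zero, hφd, map_neg]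
        simp
      · rw [hD2, hD2, map_neg, (G.exact_diff i).apply_apply_eq_zero]
        simp)
    (fun c => by
      rw [hε1, hD1, hD2, map_add, (F.exact_diff 0).apply_apply_eq_zero, hφd, map_neg]
      simp)
    (fun x => by
      obtain ⟨y, hy⟩ := Ideal.Quotient.mk_surjective (F.aug x)
      obtain ⟨w, hw⟩ := G.aug_surjective (Ideal.Quotient.mk J y)
      obtain ⟨z, hz⟩ := (F.exact_aug (x - φ 0 w)).1 (by
        rw [map_sub, haug, hw, ← hy, Ideal.Quotient.factor_mk, sub_self])
      refine ⟨Sum.elim z w, ?_⟩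
      change F.diff 0 z + φ 0 w = x
      rw [hz, sub_add_cancel]) q
    -- The homology at `F_1 ⊕ G_0` is `I/J`: the second component of a cycle maps into `I`, and by
    -- its degree into `J`.
    (fun j hj c hc hεc => by
      rw [hε1] at hεc
      have hc2 : compV (G.shift 0) j (snd 0 c) = snd 0 c := by rw [hsnd, hc]
      have h1 : Ideal.Quotient.mk I (πG (snd 0 c)) = 0 := by
        rw [← Ideal.Quotient.factor_mk hJI, ← hG1, ← haug, eq_neg_of_add_eq_zero_right hεc,
          map_neg, F.exact_aug.apply_apply_eq_zero, neg_zero]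
      have h2 : πG (snd 0 c) ∈ J := hIJ _ (Ideal.Quotient.eq_zero_iff_mem.1 h1) j hj (by
        rw [hG2, hc2])
      obtain ⟨w, hw⟩ := (G.exact_aug (snd 0 c)).1 (by
        rw [hG1, Ideal.Quotient.eq_zero_iff_mem.2 h2])
      obtain ⟨z, hz⟩ := (F.exact_diff 0 (fst 0 c + φ 1 w)).1 (by
        rw [map_add, hφd, hw, hεc])
      refine ⟨Sum.elim z (-w), hext _ _ _ ?_ ?_⟩
      · rw [hD1]
        change F.diff 1 z + φ 1 (-w) = _
        rw [hz, map_neg, add_neg_cancel_right]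
      · rw [hD2]
        change -G.diff 0 (-w) = _
        rw [map_neg, neg_neg, hw])
    (fun i j _ c _ hDc => by
      have h1 : F.diff (i + 1) (fst (i + 1) c) + φ (i + 1) (snd (i + 1) c) = 0 := by
        rw [← hD1, hDc, map_zero]
      have h2 : G.diff i (snd (i + 1) c) = 0 := by
        rw [← neg_eq_zero, ← hD2, hDc, map_zero]
      obtain ⟨w, hw⟩ := (G.exact_diff i _).1 h2
      obtain ⟨z, hz⟩ := (F.exact_diff (i + 1) (fst (i + 1) c + φ (i + 2) w)).1 (by
        rw [map_add, hφd, hw, h1])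
      refine ⟨Sum.elim z (-w), hext _ _ _ ?_ ?_⟩
      · rw [hD1]
        change F.diff (i + 2) z + φ (i + 2) (-w) = _
        rw [hz, map_neg, add_neg_cancel_right]
      · rw [hD2]
        change -G.diff (i + 1) (-w) = _
        rw [map_neg, neg_neg, hw]) Finset.univ
  have hc : compV (s i) j (Sum.elim u v) = Sum.elim u v := by
    rw [compV_sumElim, hu, hv]
  -- By minimality `φ` is the only entry of the cone differential surviving modulo the variables, so
  -- `hm` makes `(u, v)` a cycle there.
  obtain ⟨e, he⟩ : ∃ e, ∀ a, (Sum.elim u v - D i e) a ∈ varIdeal k Finset.univ := by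
    obtain _ | i := i
    · refine key.1 j (by simpa using hj) _ hc fun a => ?_
      exact add_mem (F.diff_mem_varIdeal 0 u a) (hm a)
    · refine key.2 i j hj _ hc fun a => ?_
      rcases a with a | a
      · exact add_mem (F.diff_mem_varIdeal (i + 1) u a) (hm a)
      · exact neg_mem (G.diff_mem_varIdeal i v a)
  refine ⟨fun b => ?_, snd (i + 1) e, fun a => ?_⟩
  · have h1 : v b - -(G.diff i (snd (i + 1) e) b) ∈ varIdeal k Finset.univ := he (Sum.inr b)
    rw [sub_neg_eq_add] at h1
    exact (add_mem_cancel_right (G.diff_mem_varIdeal i _ b)).1 h1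
  · have h1 : u a - (F.diff (i + 1) (fst (i + 1) e) a + φ (i + 1) (snd (i + 1) e) a) ∈
        varIdeal k Finset.univ := he (Sum.inl a)
    have h2 := add_mem h1 (F.diff_mem_varIdeal (i + 1) (fst (i + 1) e) a)
    rw [Pi.sub_apply]
    convert h2 using 1
    ring

end MinimalGradedFreeResolution

end Comparison

/-! ### Betti numbers as dimensions modulo the variables. -/

section BettiComparison

open MvPolynomial

variable {n : ℕ} {k : Type*} [Field k]

local notation "R" => MvPolynomial (Fin n) k

theorem constantCoeff_compV_of_ne {α : Type*} {s : α → ℤ} {j : ℤ} {v : α → R}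
    (hv : compV s j v = v) {a : α} (ha : s a ≠ j) : constantCoeff (v a) = 0 := by
  rw [← hv, constantCoeff_eq, compV, coeff_compZ, if_neg]
  simp only [map_zero, Nat.cast_zero]
  omega

/-- The element of degree `j` of a graded free module with the given coefficients on the basis
elements of degree `j`. -/
noncomputable def ofCoeffs {r : ℕ} (s : Fin r → ℤ) (j : ℤ) :
    ({b // s b = j} → k) →ₗ[k] (Fin r → R) where
  toFun c b := if h : s b = j then C (c ⟨b, h⟩) else 0
  map_add' c c' := by
    funext b
    by_cases h : s b = j <;> simp [h]
  map_smul' x c := by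
    funext b
    by_cases h : s b = j <;> simp [h, smul_eq_C_mul]

theorem compV_ofCoeffs {r : ℕ} (s : Fin r → ℤ) (j : ℤ) (c : {b // s b = j} → k) :
    compV s j (ofCoeffs (n := n) s j c) = ofCoeffs s j c := by
  funext b
  change compZ _ (ofCoeffs s j c b) = ofCoeffs s j c b
  rw [compZ_eq_self_iff]
  intro m hm
  change coeff m (if h : s b = j then C (c ⟨b, h⟩) else 0) ≠ 0 at hm
  split_ifs at hm with h
  · classical
    rw [coeff_C] at hm
    split_ifs at hm with h0
    · simp [← h0, h]
    · exact absurd rfl hm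
  · simp at hm

theorem constantCoeff_ofCoeffs {r : ℕ} (s : Fin r → ℤ) (j : ℤ) (c : {b // s b = j} → k)
    (b : {b // s b = j}) : constantCoeff (ofCoeffs (n := n) s j c b) = c b := by
  change constantCoeff (if h : s b = j then C (c ⟨b, h⟩) else 0) = _
  rw [dif_pos b.2, constantCoeff_C]

/-- The constant coefficients at the basis elements of degree `j`. -/
noncomputable def coeffs {r : ℕ} (s : Fin r → ℤ) (j : ℤ) :
    (Fin r → R) →ₗ[k] ({b // s b = j} → k) where
  toFun v b := constantCoeff (v b)
  map_add' v w := by funext b; simp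
  map_smul' x v := by funext b; simp [smul_eq_C_mul]

theorem coeffs_eq_zero_iff {r : ℕ} {s : Fin r → ℤ} {j : ℤ} {v : Fin r → R}
    (hv : compV s j v = v) : coeffs s j v = 0 ↔ ∀ b, v b ∈ varIdeal k Finset.univ := by
  simp only [mem_varIdeal_univ]
  constructor
  · intro h b
    by_cases hb : s b = j
    · exact congrFun h ⟨b, hb⟩
    · exact constantCoeff_compV_of_ne hv hb
  · exact fun h => funext fun b => h b

/-- The map induced modulo the variables in degree `j` by a map of graded free modules. -/
noncomputable def reducedMap {r m : ℕ} (s : Fin r → ℤ) (t : Fin m → ℤ)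
    (f : (Fin m → R) →ₗ[R] (Fin r → R)) (j : ℤ) :
    ({b // t b = j} → k) →ₗ[k] ({a // s a = j} → k) :=
  (coeffs s j).comp ((f.restrictScalars k).comp (ofCoeffs t j))

theorem reducedMap_injective {r m : ℕ} {s : Fin r → ℤ} {t : Fin m → ℤ}
    {f : (Fin m → R) →ₗ[R] (Fin r → R)}
    (hf : ∀ e c, compV s e (f c) = f (compV t e c)) {j : ℤ}
    (h : ∀ v, compV t j v = v → (∀ a, f v a ∈ varIdeal k Finset.univ) →
      ∀ b, v b ∈ varIdeal k Finset.univ) :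
    Function.Injective (reducedMap s t f j) := by
  rw [← LinearMap.ker_eq_bot, LinearMap.ker_eq_bot']
  intro c hc
  have h1 : compV s j (f (ofCoeffs t j c)) = f (ofCoeffs t j c) := by rw [hf, compV_ofCoeffs]
  have h2 := h _ (compV_ofCoeffs t j c) ((coeffs_eq_zero_iff h1).1 hc)
  funext b
  rw [← constantCoeff_ofCoeffs (n := n) t j c b]
  exact mem_varIdeal_univ.1 (h2 b)

theorem reducedMap_surjective {r m : ℕ} {s : Fin r → ℤ} {t : Fin m → ℤ}
    {f : (Fin m → R) →ₗ[R] (Fin r → R)}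
    (hf : ∀ e c, compV s e (f c) = f (compV t e c)) {j : ℤ}
    (h : ∀ u : Fin r → R, compV s j u = u →
      ∃ v : Fin m → R, ∀ a, (u - f v) a ∈ varIdeal k Finset.univ) :
    Function.Surjective (reducedMap s t f j) := by
  intro c
  obtain ⟨v, hv⟩ := h _ (compV_ofCoeffs s j c)
  refine ⟨coeffs t j (compV t j v), ?_⟩
  set w := compV t j v with hw
  have hw' : compV t j w = w := by rw [hw, compV_compV]
  -- In degree `j`, only basis elements of degree `j` can have a nonzero constant coefficient.
  have h1 : ∀ b, (w - ofCoeffs t j (coeffs t j w) : Fin m → R) b ∈ varIdeal k Finset.univ := by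
    refine (coeffs_eq_zero_iff (s := t) (j := j) ?_).1 ?_
    · rw [compV_sub, hw', compV_ofCoeffs]
    · funext b
      rw [map_sub, Pi.sub_apply, Pi.zero_apply, sub_eq_zero]
      exact (constantCoeff_ofCoeffs t j (coeffs t j w) b).symm
  have h2 : ∀ a, f (w - ofCoeffs t j (coeffs t j w)) a ∈ varIdeal k Finset.univ :=
    Ideal.map_pi _ _ h1 f
  have h3 : ∀ a, (ofCoeffs s j c - f w : Fin r → R) a ∈ varIdeal k Finset.univ := fun a => by
    rw [hw, ← hf, ← compV_ofCoeffs, ← compV_sub]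
    exact compZ_mem_varIdeal (hv a) _
  funext a
  change constantCoeff (f (ofCoeffs t j (coeffs t j w)) a) = c a
  have h4 := mem_varIdeal_univ.1 (add_mem (h2 a) (h3 a))
  rw [map_sub, Pi.sub_apply, Pi.sub_apply, sub_add_sub_comm, add_comm, ← sub_add_sub_comm,
    sub_self, add_zero, map_sub, constantCoeff_ofCoeffs, sub_eq_zero] at h4
  exact h4.symm

namespace MinimalGradedFreeResolution

variable {I J : Ideal (MvPolynomial (Fin n) k)}

theorem betti_eq_finrank (F : MinimalGradedFreeResolution I) (i : ℕ) (j : ℤ) :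
    F.betti i j = Module.finrank k ({b // F.shift i b = j} → k) := by
  rw [Module.finrank_fintype_fun_eq_card, Fintype.card_subtype, betti]

/-- Exactness of the reduced cone at spot `i`, tested on its two summands separately. The
`F`-summand there is `F_{i+1}`, so the second inequality reaches one row lower than the first. -/
theorem betti_comparison (F : MinimalGradedFreeResolution I) (G : MinimalGradedFreeResolution J)
    (hI : I.IsHomogeneous (homogeneousSubmodule (Fin n) k)) (hJI : J ≤ I) {q : ℤ}
    (hIJ : ∀ f ∈ I, ∀ j, q ≤ j → compZ j f = f → f ∈ J) :
    (∀ (i : ℕ) j, q + i ≤ j → G.betti i j ≤ F.betti i j) ∧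
    ∀ (i : ℕ) j, q + i ≤ j → F.betti (i + 1) j ≤ G.betti (i + 1) j := by
  obtain ⟨φ, hφ, hφd, haug⟩ := F.exists_chainMap G hI hJI
  have key := F.cone_exactMod G hJI hIJ hφ hφd haug
  have hz : ∀ {r : ℕ} (s : Fin r → ℤ) (j : ℤ), compV s j (0 : Fin r → R) = 0 := fun s j =>
    comp_zero s j
  refine ⟨fun i j hj => ?_, fun i j hj => ?_⟩
  · rw [F.betti_eq_finrank, G.betti_eq_finrank]
    exact LinearMap.finrank_le_finrank_of_injective (reducedMap_injective (hφ i) fun v hv hm =>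
      (key i j hj 0 v (hz _ _) hv hm).1)
  · rw [F.betti_eq_finrank, G.betti_eq_finrank]
    exact LinearMap.finrank_le_finrank_of_surjective (reducedMap_surjective (hφ (i + 1))
      fun u hu => (key i j hj u 0 hu (hz _ _) (fun a => by simp)).2)

/-- Covers homological degree `0`, which the surjectivity half of the cone argument misses; the
reason is that `R/J → R/I` is onto. -/
theorem betti_zero_le (F : MinimalGradedFreeResolution I) (G : MinimalGradedFreeResolution J)
    (hI : I.IsHomogeneous (homogeneousSubmodule (Fin n) k)) (hJI : J ≤ I) (j : ℤ) :
    F.betti 0 j ≤ G.betti 0 j := by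
  obtain ⟨φ, hφ, hφd, haug⟩ := F.exists_chainMap G hI hJI
  rw [F.betti_eq_finrank, G.betti_eq_finrank]
  refine LinearMap.finrank_le_finrank_of_surjective (reducedMap_surjective (hφ 0) fun u _ => ?_)
  obtain ⟨y, hy⟩ := Ideal.Quotient.mk_surjective (F.aug u)
  obtain ⟨w, hw⟩ := G.aug_surjective (Ideal.Quotient.mk J y)
  obtain ⟨z, hz⟩ := (F.exact_aug (u - φ 0 w)).1 (by
    rw [map_sub, haug, hw, ← hy, Ideal.Quotient.factor_mk, sub_self])
  exact ⟨w, fun a => by rw [← hz]; exact F.diff_mem_varIdeal 0 z a⟩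

/-- Let `u` in degree `0` lift `1`. Then `f u` is the boundary of some `w` of degree `D`. Without
basis elements of degree `D`, all entries of `w` lie in the maximal ideal `m`, so `f π(u) ∈ m I`. As
`π(u) - 1 ∈ I` and `f ∈ m`, also `f ∈ m I`. -/
theorem exists_shift_one_eq (F : MinimalGradedFreeResolution I)
    (hI : I.IsHomogeneous (homogeneousSubmodule (Fin n) k)) {D : ℕ} (hD : 0 < D) {f : R}
    (hfI : f ∈ I) (hfD : f.IsHomogeneous D) (hf : f ∉ idealOfVars (Fin n) k * I) :
    ∃ b, F.shift 1 b = D := by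
  by_contra! hne
  rw [← varIdeal_univ] at hf
  have hfD' : IntHomog f D := fun m hm => by
    rw [← hfD hm, Finsupp.degree_eq_weight_one]
    rfl
  obtain ⟨π, hπ1, hπ2⟩ := F.exists_lift_aug
  obtain ⟨u₀, hu₀⟩ := F.aug_surjective 1
  set u := compV (F.shift 0) 0 u₀ with hu
  have hone : compZ 0 (1 : R) = 1 := compZ_zero_one
  have hπu : π u - 1 ∈ I := by
    rw [hu, ← hπ2, ← hone, ← compZ_sub]
    refine compZ_mem_of_isHomogeneous hI (Ideal.Quotient.eq.1 ?_) _
    rw [← hπ1, hu₀, map_one]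
  obtain ⟨w₀, hw₀⟩ := (F.exact_aug (f • u)).1 (by
    rw [hπ1, map_smul, smul_eq_mul, map_mul, Ideal.Quotient.eq_zero_iff_mem.2 hfI, zero_mul])
  have hfu : compV (F.shift 0) D (f • u) = f • u := by
    funext a
    have h1 : u a = compZ (0 - F.shift 0 a) (u₀ a) := rfl
    simp only [compV, Pi.smul_apply, smul_eq_mul]
    have h2 := compZ_mul (0 - F.shift 0 a) D (u a) f hfD'
    rw [show (D : ℤ) - F.shift 0 a = 0 - F.shift 0 a + D by ring, mul_comm, h2, h1, compZ_compZ]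
  set w := compV (F.shift 1) D w₀ with hw
  have hdw : F.diff 0 w = f • u := by
    rw [hw, ← F.compV_diff, hw₀, hfu]
  have hwm : ∀ b, w b ∈ varIdeal k Finset.univ := fun b =>
    mem_varIdeal_univ.2 (constantCoeff_compV_of_ne (by rw [hw, compV_compV]) (hne b))
  have h1 : π (F.diff 0 w) ∈ varIdeal k Finset.univ * I := by
    rw [← Finset.univ_sum_single w, map_sum, map_sum]
    refine Ideal.sum_mem _ fun b _ => ?_
    rw [single_eq_smul, map_smul, map_smul]
    refine Ideal.mul_mem_mul (hwm b) (Ideal.Quotient.eq_zero_iff_mem.1 ?_)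
    rw [← hπ1, F.exact_aug.apply_apply_eq_zero]
  rw [hdw, map_smul, smul_eq_mul] at h1
  have hfm : f ∈ varIdeal k Finset.univ := by
    rw [mem_varIdeal_univ, constantCoeff_eq]
    by_contra h0
    have := hfD' 0 h0
    simp at this
    omega
  have h2 : f * (π u - 1) ∈ varIdeal k Finset.univ * I := Ideal.mul_mem_mul hfm hπu
  refine hf ?_
  have h3 := sub_mem h1 h2
  rwa [← mul_sub, sub_sub_cancel, mul_one] at h3

end MinimalGradedFreeResolution

end BettiComparison

/-! ### Application to the truncation and the maximal shifts. -/

section Truncation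

open MvPolynomial

variable {n : ℕ} {k : Type*} [Field k]

theorem truncation_le (I : HomogeneousIdeal (homogeneousSubmodule (Fin n) k)) (d : ℕ) :
    (truncation I d).toIdeal ≤ I.toIdeal :=
  Ideal.span_le.2 fun _ hf => hf.1

theorem mem_truncation (I : HomogeneousIdeal (homogeneousSubmodule (Fin n) k)) (d : ℕ)
    (f : MvPolynomial (Fin n) k) (hf : f ∈ I.toIdeal) (j : ℤ) (hj : (d : ℤ) ≤ j)
    (hfj : compZ j f = f) : f ∈ (truncation I d).toIdeal := by
  refine Ideal.subset_span ⟨hf, j.toNat, by omega, fun m hm => ?_⟩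
  change Finsupp.weight (fun _ => 1) m = j.toNat
  rw [← Finsupp.degree_eq_weight_one]
  have := compZ_eq_self_iff.1 hfj m hm
  omega

theorem gradedBetti_truncation_le (I : HomogeneousIdeal (homogeneousSubmodule (Fin n) k))
    (d i : ℕ) {j : ℤ} (hj : (i : ℤ) + d ≤ j) :
    gradedBetti (truncation I d) i j ≤ gradedBetti I i j :=
  (MinimalGradedFreeResolution.betti_comparison _ _ I.isHomogeneous (truncation_le I d)
    (mem_truncation I d)).1 i j (by omega)

theorem le_gradedBetti_truncation (I : HomogeneousIdeal (homogeneousSubmodule (Fin n) k))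
    (d i : ℕ) {j : ℤ} (hj : (i : ℤ) + d ≤ j + 1) :
    gradedBetti I i j ≤ gradedBetti (truncation I d) i j := by
  obtain _ | i := i
  · exact MinimalGradedFreeResolution.betti_zero_le _ _ I.isHomogeneous (truncation_le I d) j
  · exact (MinimalGradedFreeResolution.betti_comparison _ _ I.isHomogeneous (truncation_le I d)
      (mem_truncation I d)).2 i j (by push_cast at hj; omega)

theorem gradedBetti_ne_zero_iff (I : HomogeneousIdeal (homogeneousSubmodule (Fin n) k))
    (i : ℕ) (j : ℤ) : gradedBetti I i j ≠ 0 ↔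
      ∃ b, (nonempty_minimalGradedFreeResolution I).some.shift i b = j := by
  rw [gradedBetti, MinimalGradedFreeResolution.betti, Finset.card_ne_zero]
  simp [Finset.Nonempty]

theorem isGreatest_maxShift (I : HomogeneousIdeal (homogeneousSubmodule (Fin n) k)) (i : ℕ)
    (h : ∃ j, gradedBetti I i j ≠ 0) :
    IsGreatest {j : ℤ | gradedBetti I i j ≠ 0} (maxShift I i) := by
  have hfin : {j : ℤ | gradedBetti I i j ≠ 0}.Finite := by
    simp only [gradedBetti_ne_zero_iff]
    exact Set.finite_range _
  exact ⟨Int.csSup_mem h hfin.bddAbove, fun j hj => le_csSup hfin.bddAbove hj⟩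

/-- Up to the codimension, the resolution has basis elements in every row that has a minimal
generator. -/
theorem exists_gradedBetti_ne_zero (I : HomogeneousIdeal (homogeneousSubmodule (Fin n) k))
    {D : ℕ} (hD : 0 < D) (hgen : HasMinimalGenerator I D) (i : ℕ)
    (hi : ((i + 1 : ℕ) : ℕ∞) ≤ I.toIdeal.height) :
    ∃ j : ℤ, (D : ℤ) + i ≤ j ∧ gradedBetti I (i + 1) j ≠ 0 := by
  obtain ⟨f, hfI, hfD, hf⟩ := hgen
  have hI : I.toIdeal ≠ ⊤ := fun h => hf (by
    rw [h, Ideal.mul_top, ← varIdeal_univ, mem_varIdeal_univ, constantCoeff_eq]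
    exact hfD.coeff_eq_zero (by simpa using hD.ne))
  simp only [gradedBetti_ne_zero_iff]
  induction i with
  | zero =>
    obtain ⟨b, hb⟩ := (nonempty_minimalGradedFreeResolution I).some.exists_shift_one_eq
      I.isHomogeneous hD hfI hfD hf
    exact ⟨_, by simp [hb], b, rfl⟩
  | succ i ih =>
    obtain ⟨_, hj, a, rfl⟩ := ih (le_trans (by exact_mod_cast Nat.le_succ _) hi)
    obtain ⟨b, hb⟩ :=
      (nonempty_minimalGradedFreeResolution I).some.exists_shift_succ_gt hI hi a
    -- The shift grows by at least one, so the row does not drop.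
    exact ⟨_, le_trans (by push_cast; omega) (Int.add_one_le_of_lt hb), b, rfl⟩

end Truncation

end TruncBetti

theorem mainTheorem9 {k : Type*} [Field k] (n : ℕ)
    (I : HomogeneousIdeal (MvPolynomial.homogeneousSubmodule (Fin n) k)) (d : ℕ) (hd : 0 < d) :
    (∀ i l : ℕ, TruncBetti.gradedBetti I i ((i : ℤ) + d + l) =
      TruncBetti.gradedBetti (TruncBetti.truncation I d) i ((i : ℤ) + d + l)) ∧
    (∀ D : ℕ, IsGreatest {e : ℕ | TruncBetti.HasMinimalGenerator I e} D → d ≤ D →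
      TruncBetti.IsCohenMacaulay (MvPolynomial (Fin n) k ⧸ I.toIdeal) →
      ∀ i : ℕ, 1 ≤ i → (i : ℕ∞) ≤ I.toIdeal.height →
        IsGreatest {j : ℤ | TruncBetti.gradedBetti I i j ≠ 0} (TruncBetti.maxShift I i) ∧
        IsGreatest {j : ℤ | TruncBetti.gradedBetti (TruncBetti.truncation I d) i j ≠ 0}
          (TruncBetti.maxShift (TruncBetti.truncation I d) i) ∧
        TruncBetti.maxShift I i = TruncBetti.maxShift (TruncBetti.truncation I d) i) := by
  refine ⟨fun i l => le_antisymm (TruncBetti.le_gradedBetti_truncation I d i (by omega))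
    (TruncBetti.gradedBetti_truncation_le I d i (by omega)), ?_⟩
  intro D hD hdD _ i hi hiI
  obtain ⟨i, rfl⟩ := Nat.exists_eq_add_of_le' hi
  obtain ⟨j, hj, hj0⟩ :=
    TruncBetti.exists_gradedBetti_ne_zero I (hd.trans_le hdD) hD.1 i hiI
  have hmax := TruncBetti.isGreatest_maxShift I (i + 1) ⟨j, hj0⟩
  have hle : j ≤ TruncBetti.maxShift I (i + 1) := hmax.2 hj0
  -- The top shift is at least `D + i ≥ d + i`, which for homological index `i + 1` is only row `d -
  -- 1`; the inequality valid one row lower is what applies.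
  have hmem : TruncBetti.gradedBetti (TruncBetti.truncation I d) (i + 1)
      (TruncBetti.maxShift I (i + 1)) ≠ 0 := fun h0 =>
    hmax.1 (Nat.le_zero.1 (h0 ▸ TruncBetti.le_gradedBetti_truncation I d (i + 1)
      (by push_cast; omega)))
  have hmax' := TruncBetti.isGreatest_maxShift (TruncBetti.truncation I d) (i + 1) ⟨_, hmem⟩
  refine ⟨hmax, hmax', le_antisymm (hmax'.2 hmem) ?_⟩
  -- A larger top shift of the truncation would lie in row `d` or higher, where it is also a shift
  -- of `R/I`.
  by_contra! hlt
  refine hlt.not_ge (hmax.2 fun h0 => hmax'.1 (Nat.le_zero.1 (h0 ▸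
    TruncBetti.gradedBetti_truncation_le I d (i + 1) (by push_cast; omega))))
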